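/- **Problem.** An instance of $T$-stage $k$-robust set cover consists of a universe $U$ with $|U|=n$, a family $\mathcal F$ of $m$ subsets of $U$ that together cover $U$, costs $c:\mathcal F\to\mathbb R_{\ge 0}$, integers $n=k_0\ge k_1\ge\dots\ge k_T\ge 0$ and reals $1=\lambda_0\le\lambda_1\le\dots\le\lambda_T$. A scenario-sequence is $\mathbb A=(A_0,\dots,A_T)$ with $A_i\subseteq U$ and $|A_i|=k_i$ for all $i$ (so $A_0=U$); the elements of $\bigcap_{j\le i}A_j$ are called active on day $i$. A strategy $\Phi=(\phi_0,\dots,\phi_T)$ picks on day $i$ a collection $\phi_i(A_0,\dots,A_i)\subseteq\mathcal F$. It is feasible if for every scenario-sequence the sets picked over all days cover $\bigcap_{i\le T}A_i$. Its worst-case cost is $$\mathrm{RobCov}(\Phi)=\max_{\mathbb A}\sum_{i=0}^T\lambda_i\sum_{S\in\phi_i(A_0,\dots,A_i)}c(S),$$ and $\mathrm{Opt}$ is the least worst-case cost of a feasible strategy. **Theorem.** There is a polynomial-time $O(\log m+\log n)$-approximation algorithm for $T$-stage $k$-robust set cover, and it is thrifty. Precisely, there are a constant $C$, a polynomial $p$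 and a single program $P$ such that for every instance there are a threshold $\tau\in\mathbb R$, an output $G\subseteq\mathcal F$ of the greedy set cover algorithm (repeatedly add a set of least cost per newly covered element) for covering the net $$N=\{e\in U:\ \text{every set of }\mathcal F\text{ containing } e \text{ costs at least }\tau\},$$ a day $j^*\in\{0,\dots,T\}$ minimizing $\lambda_jk_j$, and, for each $e\in U$, a minimum-cost set $\mathrm{MinSet}(e)\in\mathcal F$ containing $e$, with the following properties. Let $\Phi$ be the strategy that picks $G$ on day $0$, picks $\mathrm{MinSet}(e)$ on day $j^*$ for every element $e$ that is active on day $j^*$ and not covered by $G$, and picks nothing otherwise (if $j^*=0$, both collections are picked on day $0$). Then: 1. $\Phi$ is feasible and $\mathrm{RobCov}(\Phi)\le\max\{1,\,C(\log m+\log n)\}\cdot\mathrm{Opt}$ (with $\log 0:=0$). 2. For every scenario-sequence and every day $i\in\{0,\dots,T\}$, the program $P$, given the instance, the day $i$ and $A_0,\dots,A_i$, outputs the collection that $\Phi$ picks on day $i$. On a random access machine that performs real additions, subtractions, multiplications and comparisons in one step each and charges natural numbers their bit length, it needs time at most $p(n+m+T)$; if all $c(S)$ and $\lambda_j$ are rational,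 then, when rational numbers are charged their bit length as well, it needs time at most $p(L)$, where $L$ is $n+m+T$ plus the total bit length of all $c(S)$ and $\lambda_j$. -/

import Mathlib

namespace RobustSetCover

/-! ### The multistage robust set cover problem -/

/-- An instance of `T`-stage `k`-robust set cover: a universe `Fin n`, a family of `m` sets with
nonnegative costs covering the universe, cardinality bounds `n = k 0 ≥ k 1 ≥ ⋯ ≥ k T` and
inflation factors `1 = lam 0 ≤ lam 1 ≤ ⋯ ≤ lam T`. -/
structure Problem where
  n : ℕ
  m : ℕ
  T : ℕ
  S : Fin m → Finset (Fin n)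
  c : Fin m → ℝ
  c_nonneg : ∀ s, 0 ≤ c s
  covers : ∀ e, ∃ s, e ∈ S s
  k : Fin (T + 1) → ℕ
  k_zero : k 0 = n
  k_anti : Antitone k
  lam : Fin (T + 1) → ℝ
  lam_zero : lam 0 = 1
  lam_mono : Monotone lam

namespace Problem

variable (I : Problem)

/-- A sequence of subsets `A 0, …, A T` of the universe. -/
abbrev Seq : Type := Fin (I.T + 1) → Finset (Fin I.n)

/-- Scenario-sequences: `|A i| = k i` on every day (so `A 0` is the whole universe). -/
def IsScenario (A : I.Seq) : Prop := ∀ i, (A i).card = I.k i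

/-- The elements active on day `i`, namely `⋂ j ≤ i, A j`. -/
def active (A : I.Seq) (i : Fin (I.T + 1)) : Finset (Fin I.n) :=
  Finset.univ.filter fun e => ∀ j, j ≤ i → e ∈ A j

/-- The elements covered by a collection of sets. -/
def cov (G : Finset (Fin I.m)) : Finset (Fin I.n) := G.biUnion I.S

/-- A strategy: on day `i` it picks a collection of sets depending only on `A 0, …, A i`. -/
structure Strategy where
  act : Fin (I.T + 1) → I.Seq → Finset (Fin I.m)
  nonanticipating : ∀ i (A B : I.Seq), (∀ j, j ≤ i → A j = B j) → act i A = act i B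

variable {I}

namespace Strategy

/-- On every scenario-sequence, the sets picked over all days cover the elements that are still
active at the end. -/
def Feasible (Φ : I.Strategy) : Prop :=
  ∀ A, I.IsScenario A →
    I.active A (Fin.last I.T) ⊆ I.cov (Finset.univ.biUnion fun i => Φ.act i A)

/-- The effective cost of the strategy on a sequence. -/
noncomputable def cost (Φ : I.Strategy) (A : I.Seq) : ℝ :=
  ∑ i, I.lam i * ∑ s ∈ Φ.act i A, I.c s

/-- The worst-case effective cost over all scenario-sequences (a nonempty finite set). -/
noncomputable def robCov (Φ : I.Strategy) : ℝ :=
  ⨆ A : {A : I.Seq // I.IsScenario A}, Φ.cost A.1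

end Strategy

variable (I)

/-- The least worst-case cost of a feasible strategy. -/
noncomputable def opt : ℝ := ⨅ Φ : {Φ : I.Strategy // Φ.Feasible}, Φ.1.robCov

/-! ### Thrifty strategies -/

/-- The net: the elements whose cheapest covering set costs at least `τ`. -/
noncomputable def net (τ : ℝ) : Finset (Fin I.n) :=
  open Classical in Finset.univ.filter fun e => ∀ s, e ∈ I.S s → τ ≤ I.c s

/-- `s` is a minimum cost set containing `e`. -/
def IsMinSet (e : Fin I.n) (s : Fin I.m) : Prop :=
  e ∈ I.S s ∧ ∀ s', e ∈ I.S s' → I.c s ≤ I.c s'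

/-- The collections that the greedy set cover algorithm for the target `N` can reach: each step
adds a set of least cost per newly covered element of `N`. -/
inductive GreedyReach (N : Finset (Fin I.n)) : Finset (Fin I.m) → Prop
  | empty : GreedyReach N ∅
  | step (G : Finset (Fin I.m)) (s : Fin I.m) (hG : GreedyReach N G)
      (hs : (I.S s ∩ (N \ I.cov G)).Nonempty)
      (hmin : ∀ s', (I.S s' ∩ (N \ I.cov G)).Nonempty →
        I.c s / ((I.S s ∩ (N \ I.cov G)).card : ℝ)
          ≤ I.c s' / ((I.S s' ∩ (N \ I.cov G)).card : ℝ)) :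
      GreedyReach N (insert s G)

/-- `G` is an output of the greedy set cover algorithm for the target `N`. -/
def IsGreedyCover (N : Finset (Fin I.n)) (G : Finset (Fin I.m)) : Prop :=
  I.GreedyReach N G ∧ N ⊆ I.cov G

/-- The thrifty strategy: pick `G` on day `0`; on day `d` pick the set `f e` for every active
element `e` not covered by `G`; do nothing on the other days. -/
def thrifty (G : Finset (Fin I.m)) (d : Fin (I.T + 1)) (f : Fin I.n → Fin I.m) : I.Strategy where
  act i A := (if i = 0 then G else ∅) ∪ (if i = d then (I.active A i \ I.cov G).image f else ∅)
  nonanticipating i A B h := by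
    have : I.active A i = I.active B i := by
      ext e
      simp only [active, Finset.mem_filter, Finset.mem_univ, true_and]
      exact forall₂_congr fun j hj => by rw [h j hj]
    rw [this]

end Problem

/-! ### A random access machine over the reals, with running times

Programs are those of a while-language whose memory consists of arrays (with two indices) of
natural numbers and arrays of real numbers. Every evaluated natural number is charged its bit
length (the logarithmic cost criterion); every evaluated real number `x` is charged `1 + w x`.
With `w = 0` this is the real RAM, one step per arithmetic operation; with `w = bitSize` rational
numbers, too, are charged their bit length. -/

/-- Memory: entry `(i, j)` of the natural-number array `a` and of the real array `a`. -/
structure Mem where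
  nat : ℕ → ℕ → ℕ → ℕ
  real : ℕ → ℕ → ℕ → ℝ

/-- Natural-number expressions; `sub` is truncated subtraction. -/
inductive NExp
  | const (v : ℕ)
  | get (a : ℕ) (i j : NExp)
  | add (x y : NExp)
  | sub (x y : NExp)
  | mul (x y : NExp)

/-- Real expressions. -/
inductive RExp
  | ofNat (x : NExp)
  | get (a : ℕ) (i j : NExp)
  | add (x y : RExp)
  | sub (x y : RExp)
  | mul (x y : RExp)

/-- Tests. -/
inductive BExp
  | natLe (x y : NExp)
  | realLe (x y : RExp)
  | not (b : BExp)
  | and (b b' : BExp)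

/-- Programs. -/
inductive Prog
  | skip
  | setNat (a : ℕ) (i j : NExp) (x : NExp)
  | setReal (a : ℕ) (i j : NExp) (x : RExp)
  | seq (P Q : Prog)
  | ite (b : BExp) (P Q : Prog)
  | loop (b : BExp) (P : Prog)

def NExp.eval (M : Mem) : NExp → ℕ
  | const v => v
  | get a i j => M.nat a (i.eval M) (j.eval M)
  | add x y => x.eval M + y.eval M
  | sub x y => x.eval M - y.eval M
  | mul x y => x.eval M * y.eval M

/-- The time to evaluate an expression: the total size of the values of all subexpressions. -/
def NExp.time (M : Mem) : NExp → ℕ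
  | const v => 1 + Nat.size v
  | get a i j => i.time M + j.time M + (1 + Nat.size ((get a i j).eval M))
  | add x y => x.time M + y.time M + (1 + Nat.size ((add x y).eval M))
  | sub x y => x.time M + y.time M + (1 + Nat.size ((sub x y).eval M))
  | mul x y => x.time M + y.time M + (1 + Nat.size ((mul x y).eval M))

noncomputable def RExp.eval (M : Mem) : RExp → ℝ
  | ofNat x => (x.eval M : ℝ)
  | get a i j => M.real a (i.eval M) (j.eval M)
  | add x y => x.eval M + y.eval M
  | sub x y => x.eval M - y.eval M
  | mul x y => x.eval M * y.eval M

noncomputable def RExp.time (w : ℝ → ℕ) (M : Mem) : RExp → ℕ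
  | ofNat x => x.time M + (1 + w ((ofNat x).eval M))
  | get a i j => i.time M + j.time M + (1 + w ((get a i j).eval M))
  | add x y => x.time w M + y.time w M + (1 + w ((add x y).eval M))
  | sub x y => x.time w M + y.time w M + (1 + w ((sub x y).eval M))
  | mul x y => x.time w M + y.time w M + (1 + w ((mul x y).eval M))

def BExp.Holds (M : Mem) : BExp → Prop
  | natLe x y => x.eval M ≤ y.eval M
  | realLe x y => x.eval M ≤ y.eval M
  | not b => ¬ b.Holds M
  | and b b' => b.Holds M ∧ b'.Holds M

noncomputable def BExp.time (w : ℝ → ℕ) (M : Mem) : BExp → ℕ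
  | natLe x y => x.time M + y.time M + 1
  | realLe x y => x.time w M + y.time w M + 1
  | not b => b.time w M + 1
  | and b b' => b.time w M + b'.time w M + 1

def Mem.setNat (M : Mem) (a i j v : ℕ) : Mem :=
  { M with nat := fun a' i' j' => if a' = a ∧ i' = i ∧ j' = j then v else M.nat a' i' j' }

noncomputable def Mem.setReal (M : Mem) (a i j : ℕ) (v : ℝ) : Mem :=
  { M with real := fun a' i' j' => if a' = a ∧ i' = i ∧ j' = j then v else M.real a' i' j' }

/-- `Exec w P M M' t`: started in memory `M`, the program `P` halts in memory `M'` after time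
`t`. -/
inductive Exec (w : ℝ → ℕ) : Prog → Mem → Mem → ℕ → Prop
  | skip (M : Mem) : Exec w .skip M M 1
  | setNat (a : ℕ) (i j x : NExp) (M : Mem) :
      Exec w (.setNat a i j x) M (M.setNat a (i.eval M) (j.eval M) (x.eval M))
        (i.time M + j.time M + x.time M + 1)
  | setReal (a : ℕ) (i j : NExp) (x : RExp) (M : Mem) :
      Exec w (.setReal a i j x) M (M.setReal a (i.eval M) (j.eval M) (x.eval M))
        (i.time M + j.time M + x.time w M + 1)
  | seq (P Q : Prog) (M M' M'' : Mem) (t t' : ℕ) (hP : Exec w P M M' t)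
      (hQ : Exec w Q M' M'' t') : Exec w (.seq P Q) M M'' (t + t')
  | ite_pos (b : BExp) (P Q : Prog) (M M' : Mem) (t : ℕ) (hb : b.Holds M)
      (hP : Exec w P M M' t) : Exec w (.ite b P Q) M M' (b.time w M + t + 1)
  | ite_neg (b : BExp) (P Q : Prog) (M M' : Mem) (t : ℕ) (hb : ¬ b.Holds M)
      (hQ : Exec w Q M M' t) : Exec w (.ite b P Q) M M' (b.time w M + t + 1)
  | loop_step (b : BExp) (P : Prog) (M M' M'' : Mem) (t t' : ℕ) (hb : b.Holds M)
      (hP : Exec w P M M' t) (hL : Exec w (.loop b P) M' M'' t') :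
      Exec w (.loop b P) M M'' (b.time w M + t + t' + 1)
  | loop_end (b : BExp) (P : Prog) (M : Mem) (hb : ¬ b.Holds M) :
      Exec w (.loop b P) M M (b.time w M + 1)

/-- The bit length of a rational number (numerator and denominator); `0` if irrational. -/
noncomputable def bitSize (x : ℝ) : ℕ :=
  open Classical in
  if h : ∃ q : ℚ, (q : ℝ) = x then Nat.size h.choose.num.natAbs + Nat.size h.choose.den else 0

namespace Problem

variable (I : Problem)

/-- The memory presented to the algorithm on day `i`: the instance, the day, and the sets
`A 0, …, A i` revealed so far. All other memory is `0`. -/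
noncomputable def input (i : Fin (I.T + 1)) (A : I.Seq) : Mem where
  nat a x y :=
    match a, x, y with
    | 0, 0, 0 => I.n
    | 0, 1, 0 => I.m
    | 0, 2, 0 => I.T
    | 0, 3, 0 => i
    | 1, j, 0 => if hj : j < I.T + 1 then I.k ⟨j, hj⟩ else 0
    | 2, s, e => if ∃ (hs : s < I.m) (he : e < I.n), (⟨e, he⟩ : Fin I.n) ∈ I.S ⟨s, hs⟩ then 1 else 0
    | 3, j, e => if ∃ (hj : j < I.T + 1) (he : e < I.n),
        (⟨j, hj⟩ : Fin (I.T + 1)) ≤ i ∧ (⟨e, he⟩ : Fin I.n) ∈ A ⟨j, hj⟩ then 1 else 0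
    | _, _, _ => 0
  real a x y :=
    match a, x, y with
    | 0, s, 0 => if hs : s < I.m then I.c ⟨s, hs⟩ else 0
    | 1, j, 0 => if hj : j < I.T + 1 then I.lam ⟨j, hj⟩ else 0
    | _, _, _ => 0

/-- The collection of sets the algorithm picks, read off array `4`. -/
def output (M : Mem) : Finset (Fin I.m) := Finset.univ.filter fun s => M.nat 4 s 0 = 1

/-- All costs and inflation factors are rational. -/
def IsRational : Prop := (∀ s, ∃ q : ℚ, (q : ℝ) = I.c s) ∧ ∀ j, ∃ q : ℚ, (q : ℝ) = I.lam j

/-- The bit length of an instance (up to a polynomial). -/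
noncomputable def bitLength : ℕ :=
  I.n + I.m + I.T + ∑ s, bitSize (I.c s) + ∑ j, bitSize (I.lam j)

/-- The program `P` carries out the strategy `Φ` in time `p`: on every day of every
scenario-sequence it computes the sets that `Φ` picks, within `p (n + m + T)` steps of the real
RAM and, if the data are rational, within `p (bit length of the instance)` bit operations. -/
def CarriesOut (P : Prog) (p : Polynomial ℕ) (Φ : I.Strategy) : Prop :=
  ∀ i A, I.IsScenario A →
    (∃ M t, Exec (fun _ => 0) P (I.input i A) M t ∧ I.output M = Φ.act i A ∧
      t ≤ p.eval (I.n + I.m + I.T)) ∧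
    (I.IsRational →
      ∃ M t, Exec bitSize P (I.input i A) M t ∧ I.output M = Φ.act i A ∧
        t ≤ p.eval I.bitLength)

end Problem

end RobustSetCover

/-! Upper bound. For a threshold `τ` the thrifty strategy pays the greedy cost of the net plus, on
the day `d` minimizing `λ_d k_d`, for at most `k_d` elements whose cheapest sets cost less than `τ`.
Its worst case is therefore at most greedy plus `W τ` with `W = min_j λ_j k_j`.

Lower bound. Let `B > Opt` and `L = log m + log n`, and choose `τ` with `W τ = 4 (L + 3) B`. The
heart of the proof, `packing_le`, says that every fractional packing `y` supported on the net then
has total at most `4 B`. Dual fitting (`GreedyReach.cost_le`) turns this into a greedy cost of at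
most `4 H_n B`, so the strategy costs `O(L) B`.

To prove `packing_le`, suppose the total `Y` of `y` exceeds `4 B`. Draw `n` independent samples from
`y / Y` and let `A_j` consist of the first `k_j` samples, padded to the right size. The first sample
stays active and almost surely lies in the net, so some day must buy a set of cost at least `τ`
containing it. The collection `F_j` of such sets bought on day `j` is invariant under permuting the
first `k_j` samples, so the first sample is covered by `F_j` with probability equal to the expected
fraction of those samples in `cov F_j`. An exponential-moment union bound over all collections shows
that this fraction is at most `2 q(cov F_j) + |F_j| (L + Z) / k_j`, where `q = y / Y` and `E Z ≤ 3`.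
Summed over the days, the mass is at most `B / Y < 1/4` because `y` is a packing, and `∑ |F_j| / k_j
≤ 1 / (4 (L + 3))` by the choice of `τ`. The first sample is thus covered with probability below
`1/2 + 1/4`, a contradiction.

Since `Opt` is unknown, the algorithm tries all nets. There are at most `n + 1` of them, and the one
with the least upper bound `val` is kept.

Running time. The program is written in a language of counted loops, for which `Code.sound` turns a
weakest-precondition proof into an execution with a polynomial time bound. Natural numbers stay
short because they are never multiplied; the real numbers are all of a few fixed shapes (`Sized`),
whose bit lengths are linear in that of the instance. -/

namespace RobustSetCover

/-! ### Greedy prices -/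

/-- Each of the `d` increments of the harmonic number is a reciprocal of an integer at most `R`. In
the greedy analysis `R` counts the uncovered elements of a set, `d` of which get covered in one step
while `a` remain. -/
theorem div_le_harmonic_sub (a d R : ℕ) (h : a + d ≤ R) :
    (d : ℝ) / R ≤ (harmonic (a + d) : ℝ) - harmonic a := by
  induction d with
  | zero => simp
  | succ d ih =>
    have h1 := ih (by omega)
    have h2 : ((harmonic (a + (d + 1)) : ℚ) : ℝ)
        = harmonic (a + d) + 1 / ((a + d + 1 : ℕ) : ℝ) := by
      rw [← add_assoc, harmonic_succ]; push_cast; simp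
    have h3 : (1 : ℝ) / R ≤ 1 / ((a + d + 1 : ℕ) : ℝ) := by
      apply one_div_le_one_div_of_le
      · positivity
      · exact_mod_cast h
    rw [h2]; push_cast at *; rw [add_div]; linarith

theorem harmonic_cast_nonneg (n : ℕ) : (0 : ℝ) ≤ (harmonic n : ℝ) := by
  have := div_le_harmonic_sub 0 n n (by omega)
  simp only [harmonic_zero, Rat.cast_zero, sub_zero, zero_add] at this
  exact le_trans (by positivity) this

theorem harmonic_cast_mono {a b : ℕ} (h : a ≤ b) : (harmonic a : ℝ) ≤ harmonic b := by
  obtain ⟨d, rfl⟩ := Nat.exists_eq_add_of_le h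
  have := div_le_harmonic_sub a d (a + d) le_rfl
  have h0 : (0 : ℝ) ≤ (d : ℝ) / ((a + d : ℕ) : ℝ) := by positivity
  linarith

namespace Problem

variable (I : Problem)

theorem cov_insert (s : Fin I.m) (G : Finset (Fin I.m)) : I.cov (insert s G) = I.S s ∪ I.cov G := by
  simp [cov, Finset.biUnion_insert]

/-- The cost of a greedy collection is split into prices of the covered elements; up to a harmonic
factor the prices are a fractional packing. -/
theorem GreedyReach.exists_price {N : Finset (Fin I.n)} {G : Finset (Fin I.m)}
    (h : I.GreedyReach N G) :
    ∃ y : Fin I.n → ℝ, (∀ e, 0 ≤ y e) ∧ (∀ e, e ∉ N → y e = 0) ∧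
      ∑ e, y e = ∑ s ∈ G, I.c s ∧
      ∀ s, ∑ e ∈ I.S s, y e ≤
        I.c s * ((harmonic (I.S s ∩ N).card : ℝ) - harmonic (I.S s ∩ (N \ I.cov G)).card) := by
  -- The subtracted harmonic number of the still uncovered part makes the bound telescope over the
  -- greedy steps.
  induction h with
  | empty => exact ⟨0, by simp, by simp, by simp, by simp [cov]⟩
  | step G s hG hs hmin ih =>
    obtain ⟨y, y0, yN, ysum, ypack⟩ := ih
    set D := I.S s ∩ (N \ I.cov G) with hD
    have hDpos : (0 : ℝ) < D.card := by exact_mod_cast hs.card_pos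
    -- The cost of the chosen set is spread evenly over the elements it newly covers.
    refine ⟨fun e => y e + if e ∈ D then I.c s / D.card else 0, ?_, ?_, ?_, ?_⟩
    · intro e
      have := I.c_nonneg s
      have := y0 e
      dsimp only
      split_ifs <;> positivity
    · intro e he
      have : e ∉ D := fun h => he (Finset.mem_sdiff.1 (Finset.mem_inter.1 h).2).1
      simp [yN e he, this]
    · have hsG : s ∉ G := by
        intro hsG
        obtain ⟨e, he⟩ := hs
        simp only [hD, Finset.mem_inter, Finset.mem_sdiff, cov, Finset.mem_biUnion] at he
        exact he.2.2 ⟨s, hsG, he.1⟩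
      rw [Finset.sum_insert hsG, Finset.sum_add_distrib, ysum, Finset.sum_ite_mem]
      simp only [Finset.univ_inter, Finset.sum_const, nsmul_eq_mul]
      field_simp
      ring
    · intro s'
      set R := I.S s' ∩ (N \ I.cov G) with hR
      have e1 : I.S s' ∩ (N \ I.cov (insert s G)) = R \ I.S s := by
        ext e
        simp only [hR, cov_insert, Finset.mem_inter, Finset.mem_sdiff, Finset.mem_union]
        tauto
      have e2 : I.S s' ∩ D = R ∩ I.S s := by
        ext e
        simp only [hR, hD, Finset.mem_inter, Finset.mem_sdiff]
        tauto
      have hcard : (R \ I.S s).card + (R ∩ I.S s).card = R.card :=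
        Finset.card_sdiff_add_card_inter R (I.S s)
      rw [Finset.sum_add_distrib, Finset.sum_ite_mem, e1, e2]
      simp only [Finset.sum_const, nsmul_eq_mul]
      have h1 := ypack s'
      -- By the greedy choice the new price is at most `c s' / |R|`, and the elements paying it move
      -- the count of uncovered elements of `s'` from `|R|` to `|R \ S s|`.
      have h2 : ((R ∩ I.S s).card : ℝ) * (I.c s / D.card)
          ≤ I.c s' * ((harmonic R.card : ℝ) - harmonic (R \ I.S s).card) := by
        rcases R.eq_empty_or_nonempty with hRe | hRne
        · simp [hRe]
        · have h3 := hmin s' hRne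
          rw [← hR] at h3
          have h4 := div_le_harmonic_sub (R \ I.S s).card (R ∩ I.S s).card R.card hcard.le
          rw [hcard] at h4
          calc ((R ∩ I.S s).card : ℝ) * (I.c s / D.card)
              ≤ (R ∩ I.S s).card * (I.c s' / R.card) := by gcongr
            _ = I.c s' * ((R ∩ I.S s).card / R.card) := by ring
            _ ≤ _ := mul_le_mul_of_nonneg_left h4 (I.c_nonneg s')
      rw [← hR] at h1
      linarith

/-- If every fractional packing supported on `N` has total at most `K`, greedy for the target `N`
pays at most `H n * K`. -/
theorem GreedyReach.cost_le {N : Finset (Fin I.n)} {G : Finset (Fin I.m)}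
    (h : I.GreedyReach N G) {K : ℝ}
    (hK : ∀ y : Fin I.n → ℝ, (∀ e, 0 ≤ y e) → (∀ e, e ∉ N → y e = 0) →
      (∀ s, ∑ e ∈ I.S s, y e ≤ I.c s) → ∑ e, y e ≤ K) :
    ∑ s ∈ G, I.c s ≤ harmonic I.n * K := by
  obtain ⟨y, y0, yN, ysum, ypack⟩ := GreedyReach.exists_price I h
  rcases Nat.eq_zero_or_pos I.n with hn | hn
  · have : IsEmpty (Fin I.n) := by rw [hn]; infer_instance
    rw [← ysum]; simp [hn]
  have hH : (0 : ℝ) < harmonic I.n := by exact_mod_cast harmonic_pos hn.ne'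
  -- Dual fitting: the prices divided by `H n` form a fractional packing.
  have := hK (fun e => y e / harmonic I.n) (fun e => div_nonneg (y0 e) hH.le)
    (fun e he => by simp [yN e he]) (fun s => by
      rw [← Finset.sum_div, div_le_iff₀ hH]
      refine (ypack s).trans (mul_le_mul_of_nonneg_left ?_ (I.c_nonneg s))
      have h1 := harmonic_cast_nonneg (I.S s ∩ (N \ I.cov G)).card
      have h2 : (harmonic (I.S s ∩ N).card : ℝ) ≤ harmonic I.n :=
        harmonic_cast_mono (by simpa using Finset.card_le_univ (I.S s ∩ N))
      linarith)
  rw [← Finset.sum_div, div_le_iff₀ hH, ysum] at this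
  linarith

end Problem

/-! ### Independent samples -/

section Samples

variable {α : Type} [Fintype α] [DecidableEq α]

/-- The number of the first `k` samples that lie in `C`. -/
def hits {n : ℕ} (k : ℕ) (C : Finset α) (x : Fin n → α) : ℕ :=
  (Finset.univ.filter fun l : Fin n => l.val < k ∧ x l ∈ C).card

/-- By independence the moment factors over the samples. With `p` the mass of `C`, each of the first
`k` contributes `exp (-2p) (1 + (e - 1) p)`, which is at most `1` since `e - 1 ≤ 2` and `1 + 2p ≤
exp (2p)`; the others contribute `1`. -/
theorem sum_prod_exp_hits_le (n : ℕ) (q : α → ℝ) (q0 : ∀ e, 0 ≤ q e) (q1 : ∑ e, q e = 1)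
    (C : Finset α) (k : ℕ) (hk : k ≤ n) :
    ∑ x : Fin n → α, (∏ i, q (x i)) * Real.exp (hits k C x - 2 * k * ∑ e ∈ C, q e) ≤ 1 := by
  set p := ∑ e ∈ C, q e with hp
  have p0 : 0 ≤ p := Finset.sum_nonneg fun e _ => q0 e
  let g : Fin n → α → ℝ := fun i e =>
    if i.val < k then Real.exp ((if e ∈ C then 1 else 0) - 2 * p) else 1
  have hexp : ∀ x : Fin n → α, Real.exp (hits k C x - 2 * k * p) = ∏ i, g i (x i) := by
    intro x
    have h1 : ∀ i, g i (x i)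
        = Real.exp (if i.val < k then ((if x i ∈ C then 1 else 0) - 2 * p) else 0) := by
      intro i; simp only [g]; split_ifs <;> simp
    rw [Finset.prod_congr rfl fun i _ => h1 i, ← Real.exp_sum]
    congr 1
    rw [← Finset.sum_filter, Finset.sum_sub_distrib, ← Finset.sum_filter, Finset.filter_filter]
    have h2 : (Finset.univ.filter fun i : Fin n => i.val < k).card = k := by
      rw [Fin.card_filter_val_lt]; omega
    simp only [Finset.sum_const, h2, nsmul_eq_mul, hits]
    ring
  have h3 : ∀ i, ∑ e, q e * g i e ≤ 1 := by
    intro i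
    by_cases hi : i.val < k
    · have h4 : ∀ e, q e * g i e
          = Real.exp (-(2 * p)) * (q e + if e ∈ C then (Real.exp 1 - 1) * q e else 0) := by
        intro e
        simp only [g, if_pos hi]
        split_ifs
        · rw [sub_eq_add_neg, Real.exp_add]; ring
        · rw [zero_sub]; ring
      rw [Finset.sum_congr rfl fun e _ => h4 e, ← Finset.mul_sum, Finset.sum_add_distrib, q1,
        Finset.sum_ite_mem, Finset.univ_inter, ← Finset.mul_sum, ← hp]
      have h5 : Real.exp 1 < 3 := lt_trans Real.exp_one_lt_d9 (by norm_num)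
      have h6 := Real.add_one_le_exp (2 * p)
      rw [Real.exp_neg, inv_mul_le_iff₀ (Real.exp_pos _)]
      nlinarith
    · simp [g, hi, q1]
  have h3' : ∀ i, 0 ≤ ∑ e, q e * g i e := fun i => Finset.sum_nonneg fun e _ =>
    mul_nonneg (q0 e) (by simp only [g]; split_ifs <;> positivity)
  calc _ = ∑ x : Fin n → α, ∏ i, q (x i) * g i (x i) :=
        Finset.sum_congr rfl fun x _ => by rw [hexp, Finset.prod_mul_distrib]
    _ = ∏ i : Fin n, ∑ e, q e * g i e := by
        rw [Finset.prod_univ_sum, Fintype.piFinset_univ]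
    _ ≤ 1 := Finset.prod_le_one (fun i _ => h3' i) (fun i _ => h3 i)

/-- If `C x` depends symmetrically on the first `k` samples, then the first sample is hit with the
same probability as an average one. -/
theorem sum_prod_hit_first {n : ℕ} (q : α → ℝ) (C : (Fin n → α) → Finset α) (k : ℕ) (hk : k ≤ n)
    (o : Fin n)
    (hsymm : ∀ (l : Fin n) x, l.val < k → C (x ∘ Equiv.swap o l) = C x) :
    k * ∑ x : Fin n → α, (∏ i, q (x i)) * (if x o ∈ C x then 1 else 0)
      = ∑ x : Fin n → α, (∏ i, q (x i)) * (hits k (C x) x : ℝ) := by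
  have h1 : ∀ l : Fin n, l.val < k →
      ∑ x : Fin n → α, (∏ i, q (x i)) * (if x o ∈ C x then (1 : ℝ) else 0)
        = ∑ x : Fin n → α, (∏ i, q (x i)) * (if x l ∈ C x then 1 else 0) := by
    intro l hl
    refine (Equiv.sum_comp (Equiv.arrowCongr (Equiv.swap o l) (Equiv.refl α)) _).symm.trans ?_
    refine Finset.sum_congr rfl fun x _ => ?_
    have e : (Equiv.arrowCongr (Equiv.swap o l) (Equiv.refl α)) x = x ∘ Equiv.swap o l := by
      ext i; simp [Equiv.arrowCongr]
    rw [e, hsymm l x hl]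
    congr 1
    · exact Equiv.prod_comp (Equiv.swap o l) (fun i => q (x i))
    · simp
  have h2 : (Finset.univ.filter fun i : Fin n => i.val < k).card = k := by
    rw [Fin.card_filter_val_lt]; omega
  calc _ = ∑ l ∈ Finset.univ.filter (fun i : Fin n => i.val < k),
          ∑ x : Fin n → α, (∏ i, q (x i)) * (if x l ∈ C x then (1 : ℝ) else 0) := by
        rw [← Finset.sum_congr rfl fun l hl => h1 l (Finset.mem_filter.1 hl).2]
        simp [h2]
    _ = _ := by
        rw [Finset.sum_comm]
        refine Finset.sum_congr rfl fun x _ => ?_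
        rw [← Finset.mul_sum, ← Finset.sum_filter, Finset.filter_filter]
        simp [hits]

end Samples


/-! ### Random nested scenarios against packings on the net -/

theorem sum_biUnion_le_sum {ι α : Type*} [DecidableEq α] [DecidableEq ι] {q : α → ℝ}
    (q0 : ∀ e, 0 ≤ q e) (F : Finset ι) (S : ι → Finset α) :
    ∑ e ∈ F.biUnion S, q e ≤ ∑ s ∈ F, ∑ e ∈ S s, q e := by
  induction F using Finset.induction_on with
  | empty => simp
  | insert s F hs ih =>
    rw [Finset.biUnion_insert, Finset.sum_insert hs]
    have h1 := Finset.sum_union_inter (s₁ := S s) (s₂ := F.biUnion S) (f := q)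
    have h2 : 0 ≤ ∑ e ∈ S s ∩ F.biUnion S, q e := Finset.sum_nonneg fun e _ => q0 e
    linarith

/-- The weights for a union bound over all collections: by the binomial theorem the sum is `(1 +
1/m)^m ≤ e`. A weight `m^(-|F|)` costs only `|F| log m` in the exponent. -/
theorem sum_inv_pow_card_le (m : ℕ) (hm : 0 < m) :
    ∑ F : Finset (Fin m), (1 / (m : ℝ)) ^ F.card ≤ 3 := by
  have h1 := Fintype.sum_pow_mul_eq_add_pow (Fin m) (1 / (m : ℝ)) 1
  simp only [one_pow, mul_one, Fintype.card_fin] at h1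
  rw [h1]
  have hm' : (0 : ℝ) < m := by exact_mod_cast hm
  calc (1 / (m : ℝ) + 1) ^ m ≤ Real.exp (1 / m) ^ m := by
        gcongr; exact Real.add_one_le_exp _
    _ = Real.exp 1 := by rw [← Real.exp_nat_mul]; congr 1; field_simp
    _ ≤ 3 := (lt_trans Real.exp_one_lt_d9 (by norm_num)).le

namespace Problem

variable (I : Problem)

theorem one_le_lam (j : Fin (I.T + 1)) : 1 ≤ I.lam j := by
  rw [← I.lam_zero]; exact I.lam_mono (Fin.zero_le j)

theorem k_le (j : Fin (I.T + 1)) : I.k j ≤ I.n := by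
  rw [← I.k_zero]; exact I.k_anti (Fin.zero_le j)

theorem m_pos (hn : 0 < I.n) : 0 < I.m := by
  obtain ⟨s, -⟩ := I.covers ⟨0, hn⟩
  exact lt_of_le_of_lt (Nat.zero_le _) s.isLt

theorem Strategy.cost_le_robCov {I : Problem} (Φ : I.Strategy) {A : I.Seq} (hA : I.IsScenario A) :
    Φ.cost A ≤ Φ.robCov :=
  le_ciSup (f := fun A : {A : I.Seq // I.IsScenario A} => Φ.cost A.1)
    (Set.finite_range _).bddAbove ⟨A, hA⟩

/-- A random nested scenario-sequence defeats every strategy that is cheaper than a quarter of a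
fractional packing supported on the net. -/
theorem packing_le {Φ : I.Strategy} (hΦ : Φ.Feasible) {B τ W : ℝ} (hB : 0 < B)
    (hcost : ∀ A, I.IsScenario A → Φ.cost A ≤ B) (hk : ∀ j, 0 < I.k j) (hW0 : 0 < W)
    (hW : ∀ j, W ≤ I.lam j * I.k j) (hτ : W * τ = 4 * (Real.log I.m + Real.log I.n + 3) * B)
    (y : Fin I.n → ℝ) (y0 : ∀ e, 0 ≤ y e) (yN : ∀ e, e ∉ I.net τ → y e = 0)
    (ypack : ∀ s, ∑ e ∈ I.S s, y e ≤ I.c s) : ∑ e, y e ≤ 4 * B := by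
  by_contra hY
  push Not at hY
  set Y := ∑ e, y e with hYdef
  have Ypos : 0 < Y := by linarith
  have npos : 0 < I.n := by rw [← I.k_zero]; exact hk 0
  have mpos := I.m_pos npos
  have nposR : (0 : ℝ) < I.n := by exact_mod_cast npos
  have mposR : (0 : ℝ) < I.m := by exact_mod_cast mpos
  set L := Real.log I.m + Real.log I.n with hL
  have logn : 0 ≤ Real.log I.n := Real.log_natCast_nonneg _
  have L0 : 0 ≤ L := add_nonneg (Real.log_natCast_nonneg _) logn
  set q : Fin I.n → ℝ := fun e => y e / Y with hq
  have q0 : ∀ e, 0 ≤ q e := fun e => div_nonneg (y0 e) Ypos.le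
  have q1 : ∑ e, q e = 1 := by simp only [hq]; rw [← Finset.sum_div, div_self Ypos.ne']
  have kn := I.k_le
  -- Samples may repeat, so sets are padded to the exact cardinality. The padding is a function of
  -- the set alone, which preserves the symmetry in the samples.
  have hpadex : ∀ (s : Finset (Fin I.n)) (j : Fin (I.T + 1)),
      ∃ t : Finset (Fin I.n), s.card ≤ I.k j → s ⊆ t ∧ t.card = I.k j := by
    intro s j
    by_cases h : s.card ≤ I.k j
    · obtain ⟨t, ht⟩ := Finset.exists_superset_card_eq h (by simpa using kn j)
      exact ⟨t, fun _ => ht⟩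
    · exact ⟨∅, fun h' => absurd h' h⟩
  choose pad hpad using hpadex
  let img : (Fin I.n → Fin I.n) → Fin (I.T + 1) → Finset (Fin I.n) := fun x j =>
    (Finset.univ.filter fun l : Fin I.n => l.val < I.k j).image x
  let A : (Fin I.n → Fin I.n) → I.Seq := fun x j => pad (img x j) j
  have imgcard : ∀ x j, (img x j).card ≤ I.k j := fun x j => by
    refine Finset.card_image_le.trans ?_
    rw [Fin.card_filter_val_lt]; exact min_le_right _ _
  have hA : ∀ x, I.IsScenario (A x) := fun x j => (hpad _ j (imgcard x j)).2
  let o : Fin I.n := ⟨0, npos⟩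
  have hoA : ∀ x j, x o ∈ A x j := fun x j =>
    (hpad _ j (imgcard x j)).1 (Finset.mem_image_of_mem x (by simp [o, hk j]))
  have imgswap : ∀ (l : Fin I.n) x j, l.val < I.k j → img (x ∘ Equiv.swap o l) j = img x j := by
    intro l x j hl
    have key : ∀ i : Fin I.n, i.val < I.k j → (Equiv.swap o l i).val < I.k j := by
      intro i hi
      rw [Equiv.swap_apply_def]
      split_ifs
      · exact hl
      · exact hk j
      · exact hi
    ext e
    simp only [img, Finset.mem_image, Finset.mem_filter, Finset.mem_univ, true_and,
      Function.comp_apply]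
    constructor
    · rintro ⟨i, hi, rfl⟩; exact ⟨_, key i hi, rfl⟩
    · rintro ⟨i, hi, rfl⟩; exact ⟨_, key i hi, by simp⟩
  -- Only these sets can contain an element of the net.
  let F : Fin (I.T + 1) → (Fin I.n → Fin I.n) → Finset (Fin I.m) := fun j x =>
    open Classical in (Φ.act j (A x)).filter fun s => τ ≤ I.c s
  -- As `k` is antitone, the swap stays within the first `k j'` samples for every `j' ≤ j`, so it
  -- changes nothing that day `j` has seen.
  have Fswap : ∀ (l : Fin I.n) x j, l.val < I.k j → F j (x ∘ Equiv.swap o l) = F j x := by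
    intro l x j hl
    have : Φ.act j (A (x ∘ Equiv.swap o l)) = Φ.act j (A x) := by
      apply Φ.nonanticipating
      intro j' hj'
      simp only [A]
      rw [imgswap l x j' (lt_of_lt_of_le hl (I.k_anti hj'))]
    simp only [F, this]
  -- the cost of the expensive sets bounds both their mass and their weighted number
  have hFcost : ∀ x, ∑ j, I.lam j * ∑ s ∈ F j x, I.c s ≤ B := by
    intro x
    refine le_trans (Finset.sum_le_sum fun j _ => ?_) (hcost (A x) (hA x))
    refine mul_le_mul_of_nonneg_left ?_ (by have := I.one_le_lam j; linarith)
    exact Finset.sum_le_sum_of_subset_of_nonneg (Finset.filter_subset _ _)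
      fun s _ _ => I.c_nonneg s
  have hmass : ∀ x, ∑ j, ∑ e ∈ I.cov (F j x), q e ≤ B / Y := by
    intro x
    rw [le_div_iff₀ Ypos, Finset.sum_mul]
    refine le_trans (Finset.sum_le_sum fun j _ => ?_) (hFcost x)
    have h1 : ∑ e ∈ I.cov (F j x), q e ≤ ∑ s ∈ F j x, ∑ e ∈ I.S s, q e := by
      simp only [cov]
      exact sum_biUnion_le_sum q0 _ _
    have h2 : ∑ s ∈ F j x, ∑ e ∈ I.S s, q e ≤ (∑ s ∈ F j x, I.c s) / Y := by
      rw [Finset.sum_div]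
      refine Finset.sum_le_sum fun s _ => ?_
      simp only [hq]; rw [← Finset.sum_div]
      exact div_le_div_of_nonneg_right (ypack s) Ypos.le
    have h3 : 0 ≤ ∑ s ∈ F j x, I.c s := Finset.sum_nonneg fun s _ => I.c_nonneg s
    have h4 := I.one_le_lam j
    have h5 := (le_div_iff₀ Ypos).1 (h1.trans h2)
    nlinarith
  have hnum : ∀ x, (∑ j, ((F j x).card : ℝ) / I.k j) * (4 * (L + 3)) ≤ 1 := by
    intro x
    have h1 : (∑ j, ((F j x).card : ℝ) / I.k j) * (W * τ) ≤ B := by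
      rw [Finset.sum_mul]
      refine le_trans (Finset.sum_le_sum fun j _ => ?_) (hFcost x)
      have kp : (0 : ℝ) < I.k j := by exact_mod_cast hk j
      have h2 : (F j x).card * τ ≤ ∑ s ∈ F j x, I.c s := by
        rw [← nsmul_eq_mul]
        exact Finset.card_nsmul_le_sum _ _ _ fun s hs => by
          simp only [F, Finset.mem_filter] at hs; exact hs.2
      have τ0 : 0 ≤ τ := by
        have : 0 ≤ W * τ := by rw [hτ]; positivity
        exact nonneg_of_mul_nonneg_right this hW0
      calc ((F j x).card : ℝ) / I.k j * (W * τ)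
          = W / I.k j * ((F j x).card * τ) := by ring
        _ ≤ I.lam j * ((F j x).card * τ) := by
            apply mul_le_mul_of_nonneg_right _ (by positivity)
            rw [div_le_iff₀ kp]; exact hW j
        _ ≤ _ := mul_le_mul_of_nonneg_left h2 (by have := I.one_le_lam j; linarith)
    rw [hτ, ← mul_assoc] at h1
    have := (mul_le_iff_le_one_left hB).1 h1
    exact this
  -- the exponential moments
  let Z : (Fin I.n → Fin I.n) → ℕ → Finset (Fin I.m) → ℝ := fun x k F =>
    Real.exp (hits k (I.cov F) x - 2 * k * ∑ e ∈ I.cov F, q e) * (1 / (I.m : ℝ)) ^ F.card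
  have Z0 : ∀ x k F, 0 ≤ Z x k F := fun x k F => by positivity
  -- `F j x` depends on the samples, so the moment bound for a fixed collection does not apply to it
  -- directly. `Zs` dominates the moments of all collections and all sample sizes at once, weighted
  -- by `m^(-|F|)` and `1/n`.
  let Zs : (Fin I.n → Fin I.n) → ℝ := fun x =>
    ∑ k ∈ Finset.Icc 1 I.n, ∑ F : Finset (Fin I.m), Z x k F / I.n
  have Zs0 : ∀ x, 0 ≤ Zs x := fun x => Finset.sum_nonneg fun k _ => Finset.sum_nonneg fun F _ =>
    div_nonneg (Z0 x k F) nposR.le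
  let P : (Fin I.n → Fin I.n) → ℝ := fun x => ∏ i, q (x i)
  have P0 : ∀ x, 0 ≤ P x := fun x => Finset.prod_nonneg fun i _ => q0 _
  have P1 : ∑ x, P x = 1 := by
    have h1 := Finset.prod_univ_sum (fun _ : Fin I.n => (Finset.univ : Finset (Fin I.n)))
      (fun _ e => q e)
    rw [Fintype.piFinset_univ] at h1
    simp only [P]
    rw [← h1]; simp [q1]
  have hEZ : ∑ x, P x * Zs x ≤ 3 := by
    have h1 : ∀ k ∈ Finset.Icc 1 I.n, ∀ F : Finset (Fin I.m),
        ∑ x, P x * (Z x k F / I.n) ≤ (1 / (I.m : ℝ)) ^ F.card / I.n := by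
      intro k hk F
      have h2 := sum_prod_exp_hits_le I.n q q0 q1 (I.cov F) k (Finset.mem_Icc.1 hk).2
      calc ∑ x, P x * (Z x k F / I.n)
          = (∑ x, P x * Real.exp (hits k (I.cov F) x - 2 * k * ∑ e ∈ I.cov F, q e))
              * ((1 / (I.m : ℝ)) ^ F.card / I.n) := by
            rw [Finset.sum_mul]
            exact Finset.sum_congr rfl fun x _ => by simp only [Z]; ring
        _ ≤ 1 * ((1 / (I.m : ℝ)) ^ F.card / I.n) :=
            mul_le_mul_of_nonneg_right h2 (by positivity)
        _ = _ := one_mul _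
    calc ∑ x, P x * Zs x
        = ∑ k ∈ Finset.Icc 1 I.n, ∑ F : Finset (Fin I.m), ∑ x, P x * (Z x k F / I.n) := by
          simp only [Zs, Finset.mul_sum]
          rw [Finset.sum_comm]
          exact Finset.sum_congr rfl fun k _ => Finset.sum_comm
      _ ≤ ∑ k ∈ Finset.Icc 1 I.n, ∑ F : Finset (Fin I.m), (1 / (I.m : ℝ)) ^ F.card / I.n :=
          Finset.sum_le_sum fun k hk => Finset.sum_le_sum fun F _ => h1 k hk F
      _ ≤ ∑ k ∈ Finset.Icc 1 I.n, 3 / (I.n : ℝ) := by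
          refine Finset.sum_le_sum fun k _ => ?_
          rw [← Finset.sum_div]
          exact div_le_div_of_nonneg_right (sum_inv_pow_card_le I.m mpos) nposR.le
      _ = 3 := by
          rw [Finset.sum_const, Nat.card_Icc, nsmul_eq_mul]
          simp only [Nat.add_sub_cancel]; field_simp
  -- The weighted moment of the actual pair `(k j, F j x)` is at most `Zs x`, and `t + 1 ≤ exp t`
  -- makes this linear. An empty collection has no hits; otherwise `|F| ≥ 1` lets `|F|` multiply
  -- `log n` and `Zs x`.
  have hhits : ∀ x j, (hits (I.k j) (I.cov (F j x)) x : ℝ)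
      ≤ I.k j * (2 * ∑ e ∈ I.cov (F j x), q e) + (F j x).card * (L + Zs x) := by
    intro x j
    rcases (F j x).eq_empty_or_nonempty with he | hne
    · rw [he]; simp [cov, hits]
    have hc : (1 : ℝ) ≤ (F j x).card := by exact_mod_cast hne.card_pos
    set t := (hits (I.k j) (I.cov (F j x)) x : ℝ) - 2 * I.k j * ∑ e ∈ I.cov (F j x), q e with ht
    have h1 : Z x (I.k j) (F j x) / I.n
        = Real.exp (t - (F j x).card * Real.log I.m - Real.log I.n) := by
      rw [Real.exp_sub, Real.exp_sub, Real.exp_log nposR, Real.exp_nat_mul, Real.exp_log mposR]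
      simp only [Z, ← ht]; rw [one_div, inv_pow]; ring
    have h2 := Real.add_one_le_exp (t - (F j x).card * Real.log I.m - Real.log I.n)
    rw [← h1] at h2
    have h3 : Z x (I.k j) (F j x) / I.n ≤ Zs x := by
      refine le_trans ?_ (Finset.single_le_sum (f := fun k => ∑ F, Z x k F / I.n)
        (fun k _ => Finset.sum_nonneg fun F _ => div_nonneg (Z0 x k F) nposR.le)
        (Finset.mem_Icc.2 ⟨hk j, kn j⟩))
      exact Finset.single_le_sum (f := fun F => Z x (I.k j) F / I.n)
        (fun F _ => div_nonneg (Z0 x _ F) nposR.le) (Finset.mem_univ _)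
    have h4 := Zs0 x
    have h5 : Zs x ≤ (F j x).card * Zs x := le_mul_of_one_le_left h4 hc
    have h6 : Real.log I.n ≤ (F j x).card * Real.log I.n := le_mul_of_one_le_left logn hc
    have h7 : ((F j x).card : ℝ) * (L + Zs x) = (F j x).card * Real.log I.m
        + (F j x).card * Real.log I.n + (F j x).card * Zs x := by rw [hL]; ring
    rw [h7]
    linarith
  have hfirst : ∀ j, ∑ x, P x * (if x o ∈ I.cov (F j x) then (1 : ℝ) else 0)
      ≤ ∑ x, P x * (2 * (∑ e ∈ I.cov (F j x), q e) + (F j x).card / I.k j * (L + Zs x)) := by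
    intro j
    have kp : (0 : ℝ) < I.k j := by exact_mod_cast hk j
    have h1 := sum_prod_hit_first q (fun x => I.cov (F j x)) (I.k j) (kn j) o
      (fun l x hl => by simp only [Fswap l x j hl])
    refine le_of_mul_le_mul_left ?_ kp
    refine h1.trans_le ?_
    rw [Finset.mul_sum]
    refine Finset.sum_le_sum fun x _ => ?_
    have h2 := mul_le_mul_of_nonneg_left (hhits x j) (P0 x)
    refine h2.trans_eq ?_
    simp only [P]; field_simp
  -- The expected number of days covering the first sample is at most `2 B / Y + (L + 3) / (4 (L +
  -- 3))`, where `B / Y < 1/4`.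
  have htotal : ∑ x, P x * ∑ j, (if x o ∈ I.cov (F j x) then (1 : ℝ) else 0) < 1 := by
    have h1 : ∑ x, P x * ∑ j, (if x o ∈ I.cov (F j x) then (1 : ℝ) else 0)
        = ∑ j, ∑ x, P x * (if x o ∈ I.cov (F j x) then (1 : ℝ) else 0) := by
      rw [Finset.sum_comm]; exact Finset.sum_congr rfl fun x _ => Finset.mul_sum _ _ _
    have hL3 : 0 < 4 * (L + 3) := by linarith
    have h2 : ∀ x, ∑ j, (2 * (∑ e ∈ I.cov (F j x), q e) + (F j x).card / I.k j * (L + Zs x))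
        ≤ 2 * (B / Y) + (L + Zs x) / (4 * (L + 3)) := by
      intro x
      rw [Finset.sum_add_distrib, ← Finset.mul_sum, ← Finset.sum_mul]
      have h3 := hmass x
      have h4 := (le_div_iff₀ hL3).2 (hnum x)
      have h5 := mul_le_mul_of_nonneg_right h4 (add_nonneg L0 (Zs0 x))
      rw [one_div, inv_mul_eq_div] at h5
      linarith
    calc _ = ∑ j, ∑ x, P x * (if x o ∈ I.cov (F j x) then (1 : ℝ) else 0) := h1
      _ ≤ ∑ j, ∑ x, P x *
            (2 * (∑ e ∈ I.cov (F j x), q e) + (F j x).card / I.k j * (L + Zs x)) :=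
          Finset.sum_le_sum fun j _ => hfirst j
      _ = ∑ x, P x * ∑ j,
            (2 * (∑ e ∈ I.cov (F j x), q e) + (F j x).card / I.k j * (L + Zs x)) := by
          rw [Finset.sum_comm]; exact Finset.sum_congr rfl fun x _ => (Finset.mul_sum _ _ _).symm
      _ ≤ ∑ x, P x * (2 * (B / Y) + (L + Zs x) / (4 * (L + 3))) :=
          Finset.sum_le_sum fun x _ => mul_le_mul_of_nonneg_left (h2 x) (P0 x)
      _ = (2 * (B / Y) + L / (4 * (L + 3))) * ∑ x, P x
            + (∑ x, P x * Zs x) / (4 * (L + 3)) := by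
          rw [Finset.mul_sum, Finset.sum_div, ← Finset.sum_add_distrib]
          exact Finset.sum_congr rfl fun x _ => by ring
      _ ≤ 2 * (B / Y) + L / (4 * (L + 3)) + 3 / (4 * (L + 3)) := by
          rw [P1, mul_one]
          gcongr
      _ = 2 * (B / Y) + 1 / 4 := by field_simp; ring
      _ < 1 := by
          have : B / Y < 1 / 4 := by rw [div_lt_iff₀ Ypos]; linarith
          linarith
  -- The strict comparison with `P x` forces `P x > 0`, so that `x o` lies in the support of `y`,
  -- hence in the net.
  obtain ⟨x, -, hx⟩ : ∃ x ∈ Finset.univ,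
      P x * ∑ j, (if x o ∈ I.cov (F j x) then (1 : ℝ) else 0) < P x :=
    Finset.exists_lt_of_sum_lt (by rw [P1]; exact htotal)
  have hnone : ∀ j, x o ∉ I.cov (F j x) := by
    intro j hj
    have h1 : (1 : ℝ) ≤ ∑ j, (if x o ∈ I.cov (F j x) then (1 : ℝ) else 0) := by
      refine le_trans ?_ (Finset.single_le_sum (fun j _ => ?_) (Finset.mem_univ j))
      · simp [hj]
      · split_ifs <;> norm_num
    exact absurd hx (not_lt.2 (le_mul_of_one_le_right (P0 x) h1))
  have hxo : x o ∈ I.net τ := by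
    by_contra h
    have : P x = 0 := Finset.prod_eq_zero (Finset.mem_univ o) (by simp [hq, yN _ h])
    rw [this] at hx; simp at hx
  have hcov := hΦ (A x) (hA x) (show x o ∈ _ by
    simp only [active, Finset.mem_filter, Finset.mem_univ, true_and]
    exact fun j _ => hoA x j)
  simp only [cov, Finset.mem_biUnion, Finset.mem_univ, true_and] at hcov
  obtain ⟨s, ⟨j, hj⟩, hs⟩ := hcov
  refine hnone j ?_
  simp only [cov, Finset.mem_biUnion]
  refine ⟨s, ?_, hs⟩
  simp only [net, Finset.mem_filter, Finset.mem_univ, true_and] at hxo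
  simp only [F, Finset.mem_filter]
  exact ⟨hj, hxo s hs⟩

end Problem


/-! ### Static data of expressions -/

/-- The size of an expression. -/
def NExp.len : NExp → ℕ
  | const v => 1 + Nat.size v
  | get _ i j => i.len + j.len + 1
  | add x y => x.len + y.len + 1
  | sub x y => x.len + y.len + 1
  | mul x y => x.len + y.len + 1

/-- The expression is free of multiplications. -/
def NExp.plain : NExp → Bool
  | const _ => true
  | get _ i j => i.plain && j.plain
  | add x y => x.plain && y.plain
  | sub x y => x.plain && y.plain
  | mul _ _ => false

/-- The arrays an expression reads. -/
def NExp.reads : NExp → List ℕ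
  | const _ => []
  | get a i j => a :: (i.reads ++ j.reads)
  | add x y => x.reads ++ y.reads
  | sub x y => x.reads ++ y.reads
  | mul x y => x.reads ++ y.reads

/-- The size of an expression. -/
def RExp.len : RExp → ℕ
  | ofNat x => x.len + 1
  | get _ i j => i.len + j.len + 1
  | add x y => x.len + y.len + 1
  | sub x y => x.len + y.len + 1
  | mul x y => x.len + y.len + 1

/-- No natural-number subexpression contains a multiplication. -/
def RExp.plain : RExp → Bool
  | ofNat x => x.plain
  | get _ i j => i.plain && j.plain
  | add x y => x.plain && y.plain
  | sub x y => x.plain && y.plain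
  | mul x y => x.plain && y.plain

/-- The size of an expression. -/
def BExp.len : BExp → ℕ
  | natLe x y => x.len + y.len + 1
  | realLe x y => x.len + y.len + 1
  | not b => b.len + 1
  | and b b' => b.len + b'.len + 1

/-- No natural-number subexpression contains a multiplication. -/
def BExp.plain : BExp → Bool
  | natLe x y => x.plain && y.plain
  | realLe x y => x.plain && y.plain
  | not b => b.plain
  | and b b' => b.plain && b'.plain

/-- All values of real subexpressions have size at most `R`. -/
def RExp.Ok (w : ℝ → ℕ) (R : ℕ) (M : Mem) : RExp → Prop
  | ofNat x => w ((ofNat x).eval M) ≤ R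
  | get a i j => w ((get a i j).eval M) ≤ R
  | add x y => x.Ok w R M ∧ y.Ok w R M ∧ w ((add x y).eval M) ≤ R
  | sub x y => x.Ok w R M ∧ y.Ok w R M ∧ w ((sub x y).eval M) ≤ R
  | mul x y => x.Ok w R M ∧ y.Ok w R M ∧ w ((mul x y).eval M) ≤ R

/-- All values of real subexpressions have size at most `R`. -/
def BExp.Ok (w : ℝ → ℕ) (R : ℕ) (M : Mem) : BExp → Prop
  | natLe _ _ => True
  | realLe x y => x.Ok w R M ∧ y.Ok w R M
  | not b => b.Ok w R M
  | and b b' => b.Ok w R M ∧ b'.Ok w R M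

/-- All natural numbers in the memory have at most `β` bits. -/
def Mem.Bits (M : Mem) (β : ℕ) : Prop := ∀ a i j, Nat.size (M.nat a i j) ≤ β

theorem size_add_le (x y b : ℕ) (hx : Nat.size x ≤ b) (hy : Nat.size y ≤ b) :
    Nat.size (x + y) ≤ b + 1 := by
  rw [Nat.size_le] at *
  rw [pow_succ]; omega

/-- Without multiplications every operation lengthens the longer operand by at most one bit, so bit
lengths grow additively. This is why `plain` is imposed. -/
theorem NExp.size_eval_le {M : Mem} {β : ℕ} (hM : M.Bits β) (e : NExp) (he : e.plain = true) :
    Nat.size (e.eval M) ≤ β + e.len := by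
  induction e with
  | const v => simp only [eval, len]; omega
  | get a i j _ _ => simp only [eval, len]; have := hM a (i.eval M) (j.eval M); omega
  | add x y ihx ihy =>
    simp only [plain, Bool.and_eq_true] at he
    have h1 := ihx he.1
    have h2 := ihy he.2
    have := size_add_le (x.eval M) (y.eval M) (β + x.len + y.len) (by omega) (by omega)
    simp only [eval, len]; omega
  | sub x y ihx ihy =>
    simp only [plain, Bool.and_eq_true] at he
    have h1 := ihx he.1
    have : Nat.size (x.eval M - y.eval M) ≤ Nat.size (x.eval M) := Nat.size_le_size (Nat.sub_le _ _)
    simp only [eval, len]; omega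
  | mul x y _ _ => simp [plain] at he

theorem NExp.time_le {M : Mem} {β K : ℕ} (hM : M.Bits β) (e : NExp) (he : e.plain = true)
    (hK : 1 + β + e.len ≤ K) : e.time M ≤ e.len * K := by
  have hs := e.size_eval_le hM he
  induction e with
  | const v =>
    simp only [time, len] at *
    calc 1 + Nat.size v ≤ (1 + Nat.size v) * 1 := by omega
      _ ≤ _ := Nat.mul_le_mul_left _ (by omega)
  | get a x y ihx ihy =>
    simp only [plain, Bool.and_eq_true] at he
    simp only [len] at hK hs
    have h1 := ihx he.1 (by omega) (x.size_eval_le hM he.1)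
    have h2 := ihy he.2 (by omega) (y.size_eval_le hM he.2)
    simp only [time, len, add_mul, one_mul]; omega
  | add x y ihx ihy =>
    simp only [plain, Bool.and_eq_true] at he
    simp only [len] at hK hs
    have h1 := ihx he.1 (by omega) (x.size_eval_le hM he.1)
    have h2 := ihy he.2 (by omega) (y.size_eval_le hM he.2)
    simp only [time, len, add_mul, one_mul]; omega
  | sub x y ihx ihy =>
    simp only [plain, Bool.and_eq_true] at he
    simp only [len] at hK hs
    have h1 := ihx he.1 (by omega) (x.size_eval_le hM he.1)
    have h2 := ihy he.2 (by omega) (y.size_eval_le hM he.2)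
    simp only [time, len, add_mul, one_mul]; omega
  | mul x y _ _ => simp [plain] at he

theorem RExp.time_le {w : ℝ → ℕ} {R : ℕ} {M : Mem} {β K : ℕ} (hM : M.Bits β) (e : RExp)
    (he : e.plain = true) (hok : e.Ok w R M) (hK : 1 + β + e.len ≤ K) (hR : 1 + R ≤ K) :
    e.time w M ≤ e.len * K := by
  induction e with
  | ofNat x =>
    simp only [len, plain, Ok] at *
    have := x.time_le hM he (by omega : _ ≤ K)
    simp only [time, add_mul, one_mul]; omega
  | get a x y =>
    simp only [len, plain, Ok, Bool.and_eq_true] at *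
    have h1 := x.time_le hM he.1 (by omega : _ ≤ K)
    have h2 := y.time_le hM he.2 (by omega : _ ≤ K)
    simp only [time, add_mul, one_mul]; omega
  | add x y ihx ihy =>
    simp only [len, plain, Ok, Bool.and_eq_true] at *
    have h1 := ihx he.1 hok.1 (by omega)
    have h2 := ihy he.2 hok.2.1 (by omega)
    simp only [time, add_mul, one_mul]; omega
  | sub x y ihx ihy =>
    simp only [len, plain, Ok, Bool.and_eq_true] at *
    have h1 := ihx he.1 hok.1 (by omega)
    have h2 := ihy he.2 hok.2.1 (by omega)
    simp only [time, add_mul, one_mul]; omega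
  | mul x y ihx ihy =>
    simp only [len, plain, Ok, Bool.and_eq_true] at *
    have h1 := ihx he.1 hok.1 (by omega)
    have h2 := ihy he.2 hok.2.1 (by omega)
    simp only [time, add_mul, one_mul]; omega

theorem BExp.time_le {w : ℝ → ℕ} {R : ℕ} {M : Mem} {β K : ℕ} (hM : M.Bits β) (e : BExp)
    (he : e.plain = true) (hok : e.Ok w R M) (hK : 1 + β + e.len ≤ K) (hR : 1 + R ≤ K) :
    e.time w M ≤ e.len * K := by
  induction e with
  | natLe x y =>
    simp only [len, plain, Bool.and_eq_true] at *
    have h1 := x.time_le hM he.1 (by omega : _ ≤ K)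
    have h2 := y.time_le hM he.2 (by omega : _ ≤ K)
    simp only [time, add_mul, one_mul]; omega
  | realLe x y =>
    simp only [len, plain, Ok, Bool.and_eq_true] at *
    have h1 := x.time_le hM he.1 hok.1 (by omega : _ ≤ K) hR
    have h2 := y.time_le hM he.2 hok.2 (by omega : _ ≤ K) hR
    simp only [time, add_mul, one_mul]; omega
  | not b ih =>
    simp only [len, plain, Ok] at *
    have h1 := ih he hok (by omega)
    simp only [time, add_mul, one_mul]; omega
  | and x y ihx ihy =>
    simp only [len, plain, Ok, Bool.and_eq_true] at *
    have h1 := ihx he.1 hok.1 (by omega)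
    have h2 := ihy he.2 hok.2 (by omega)
    simp only [time, add_mul, one_mul]; omega

/-- The memories agree outside the natural-number arrays in `a` and the real arrays in `r`. -/
def Agree (a r : List ℕ) (M M' : Mem) : Prop :=
  (∀ x ∉ a, M'.nat x = M.nat x) ∧ ∀ x ∉ r, M'.real x = M.real x

theorem Agree.refl (a r : List ℕ) (M : Mem) : Agree a r M M := ⟨fun _ _ => rfl, fun _ _ => rfl⟩

theorem Agree.trans {a r : List ℕ} {M M' M'' : Mem} (h : Agree a r M M') (h' : Agree a r M' M'') :
    Agree a r M M'' :=
  ⟨fun x hx => (h'.1 x hx).trans (h.1 x hx), fun x hx => (h'.2 x hx).trans (h.2 x hx)⟩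

theorem Agree.mono {a r a' r' : List ℕ} {M M' : Mem} (h : Agree a r M M') (ha : a ⊆ a')
    (hr : r ⊆ r') : Agree a' r' M M' :=
  ⟨fun x hx => h.1 x fun h' => hx (ha h'), fun x hx => h.2 x fun h' => hx (hr h')⟩

theorem agree_setNat (M : Mem) (a i j v : ℕ) (r : List ℕ) : Agree [a] r M (M.setNat a i j v) := by
  refine ⟨fun x hx => ?_, fun _ _ => rfl⟩
  funext y z
  simp only [List.mem_singleton] at hx
  simp [Mem.setNat, hx]

theorem agree_setReal (M : Mem) (a i j : ℕ) (v : ℝ) (l : List ℕ) :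
    Agree l [a] M (M.setReal a i j v) := by
  refine ⟨fun _ _ => rfl, fun x hx => ?_⟩
  funext y z
  simp only [List.mem_singleton] at hx
  simp [Mem.setReal, hx]

theorem NExp.eval_agree {a r : List ℕ} {M M' : Mem} (h : Agree a r M M') (e : NExp)
    (he : ∀ x ∈ e.reads, x ∉ a) : e.eval M' = e.eval M := by
  induction e with
  | const v => rfl
  | get b i j hi hj =>
    simp only [reads, List.mem_cons, List.mem_append] at he
    simp only [eval]
    rw [hi fun x hx => he x (Or.inr (Or.inl hx)), hj fun x hx => he x (Or.inr (Or.inr hx)),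
      h.1 b (he b (Or.inl rfl))]
  | add x y hx hy | sub x y hx hy | mul x y hx hy =>
    simp only [reads, List.mem_append] at he
    simp only [eval]
    rw [hx fun z hz => he z (Or.inl hz), hy fun z hz => he z (Or.inr hz)]

/-! ### A language of bounded loops -/

/-- The scalar stored in entry `(0, 0)` of the array `a`. -/
abbrev NExp.var (a : ℕ) : NExp := .get a (.const 0) (.const 0)

/-- Programs whose only loops are counted. -/
inductive Code
  | skip
  | setNat (a : ℕ) (i j : NExp) (x : NExp)
  | setReal (a : ℕ) (i j : NExp) (x : RExp)
  | seq (P Q : Code)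
  | ite (b : BExp) (P Q : Code)
  | rep (v : ℕ) (N : NExp) (P : Code)

namespace Code

/-- The test of the loop `for v < N`. -/
def loopTest (v : ℕ) (N : NExp) : BExp := .natLe (.add (.var v) (.const 1)) N

/-- The translation to programs. -/
def toProg : Code → Prog
  | skip => .skip
  | setNat a i j x => .setNat a i j x
  | setReal a i j x => .setReal a i j x
  | seq P Q => .seq P.toProg Q.toProg
  | ite b P Q => .ite b P.toProg Q.toProg
  | rep v N P => .seq (.setNat v (.const 0) (.const 0) (.const 0))
      (.loop (loopTest v N) (.seq P.toProg
        (.setNat v (.const 0) (.const 0) (.add (.var v) (.const 1)))))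

/-- The natural-number arrays that are written. -/
def modN : Code → List ℕ
  | skip => []
  | setNat a _ _ _ => [a]
  | setReal _ _ _ _ => []
  | seq P Q => P.modN ++ Q.modN
  | ite _ P Q => P.modN ++ Q.modN
  | rep v _ P => v :: P.modN

/-- The real arrays that are written. -/
def modR : Code → List ℕ
  | skip => []
  | setNat _ _ _ _ => []
  | setReal a _ _ _ => [a]
  | seq P Q => P.modR ++ Q.modR
  | ite _ P Q => P.modR ++ Q.modR
  | rep _ _ P => P.modR

/-- No expression contains a multiplication of natural numbers, and no loop changes its counter or
its bound. -/
def wf : Code → Bool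
  | skip => true
  | setNat _ i j x => i.plain && (j.plain && x.plain)
  | setReal _ i j x => i.plain && (j.plain && x.plain)
  | seq P Q => P.wf && Q.wf
  | ite b P Q => b.plain && (P.wf && Q.wf)
  | rep v N P => N.plain && (P.wf && (decide (v ∉ P.modN) &&
      decide (∀ x ∈ N.reads, x ∉ v :: P.modN)))

/-- A bound, as a polynomial in a bound on the number of iterations of every loop, on the total size
of all expressions that are evaluated. -/
noncomputable def work : Code → Polynomial ℕ
  | skip => 1
  | setNat _ i j x => Polynomial.C (i.len + j.len + x.len + 1)
  | setReal _ i j x => Polynomial.C (i.len + j.len + x.len + 1)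
  | seq P Q => P.work + Q.work
  | ite b P Q => Polynomial.C (b.len + 1) + P.work + Q.work
  -- Initializing the counter takes time `4`; the factor `X + 1` includes the final failing test;
  -- `20` generously pays for incrementing the counter and the bookkeeping of one round.
  | rep v N P => Polynomial.C 4 +
      (Polynomial.X + 1) * (Polynomial.C ((loopTest v N).len + 20) + P.work)

/-- Weakest preconditions of loops. -/
def loopWp (f : (Mem → Prop) → Mem → Prop) (v : ℕ) : ℕ → ℕ → (Mem → Prop) → Mem → Prop
  | 0, _, Q, M => Q M
  | k + 1, i, Q, M => f (fun M' => loopWp f v k (i + 1) Q (M'.setNat v 0 0 (i + 1))) M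

/-- Weakest preconditions: started in `M`, the code ends in a memory satisfying `Q`, all loops have
at most `D` iterations, and all evaluated real numbers have size at most `R`. -/
def wp (w : ℝ → ℕ) (R D : ℕ) : Code → (Mem → Prop) → Mem → Prop
  | skip, Q, M => Q M
  | setNat a i j x, Q, M => Q (M.setNat a (i.eval M) (j.eval M) (x.eval M))
  | setReal a i j x, Q, M => x.Ok w R M ∧ Q (M.setReal a (i.eval M) (j.eval M) (x.eval M))
  | seq P P', Q, M => P.wp w R D (P'.wp w R D Q) M
  | ite b P P', Q, M =>
      b.Ok w R M ∧ (b.Holds M → P.wp w R D Q M) ∧ (¬ b.Holds M → P'.wp w R D Q M)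
  | rep v N P, Q, M =>
      N.eval M ≤ D ∧ loopWp (P.wp w R D) v (N.eval M) 0 Q (M.setNat v 0 0 0)

variable {w : ℝ → ℕ} {R D : ℕ}

theorem agree_setNat_cons {l r : List ℕ} {v x : ℕ} {M M' : Mem} (h : Agree l r M M') :
    Agree (v :: l) r M (M'.setNat v 0 0 x) :=
  (h.mono (List.subset_cons_self _ _) (List.Subset.refl _)).trans
    ((agree_setNat M' v 0 0 x r).mono (by simp) (List.Subset.refl _))

/-- Consequence and frame rule. -/
theorem wp_conseq (P : Code) {Q Q' : Mem → Prop} {M : Mem} (h : P.wp w R D Q M)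
    (hQ : ∀ M', Agree P.modN P.modR M M' → Q M' → Q' M') : P.wp w R D Q' M := by
  induction P generalizing Q Q' M with
  | skip => exact hQ _ (Agree.refl _ _ _) h
  | setNat a i j x => exact hQ _ (agree_setNat _ _ _ _ _ _) h
  | setReal a i j x => exact ⟨h.1, hQ _ (agree_setReal _ _ _ _ _ _) h.2⟩
  | seq P P' ih ih' =>
    refine ih h fun M' hM' h' => ih' h' fun M'' hM'' h'' => hQ M'' ?_ h''
    exact (hM'.mono (by simp [modN]) (by simp [modR])).trans
      (hM''.mono (by simp [modN]) (by simp [modR]))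
  | ite b P P' ih ih' =>
    refine ⟨h.1, fun hb => ih (h.2.1 hb) fun M' hM' => hQ M' ?_,
      fun hb => ih' (h.2.2 hb) fun M' hM' => hQ M' ?_⟩
    · exact hM'.mono (by simp [modN]) (by simp [modR])
    · exact hM'.mono (by simp [modN]) (by simp [modR])
  | rep v N P ih =>
    refine ⟨h.1, ?_⟩
    have key : ∀ k i M', Agree (v :: P.modN) P.modR M M' →
        loopWp (P.wp w R D) v k i Q M' → loopWp (P.wp w R D) v k i Q' M' := by
      intro k
      induction k with
      | zero => intro i M' hM' h'; exact hQ M' hM' h'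
      | succ k ihk =>
        intro i M' hM' h'
        exact ih h' fun M'' hM'' h'' =>
          ihk (i + 1) _ (hM'.trans (agree_setNat_cons hM'')) h''
    exact key _ _ _ (agree_setNat_cons (Agree.refl _ _ _)) h.2

/-- The invariant rule for counted loops. -/
theorem wp_rep (Inv : ℕ → Mem → Prop) {v : ℕ} {N : NExp} {P : Code} {Q : Mem → Prop} {M : Mem}
    {B : ℕ} (hB : N.eval M = B) (hD : B ≤ D) (h0 : Inv 0 (M.setNat v 0 0 0))
    (hs : ∀ i < B, ∀ M', Agree (v :: P.modN) P.modR M M' → M'.nat v 0 0 = i → Inv i M' →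
      P.wp w R D (fun M'' => Inv (i + 1) (M''.setNat v 0 0 (i + 1))) M')
    (hQ : ∀ M', Agree (v :: P.modN) P.modR M M' → Inv B M' → Q M') :
    (rep v N P).wp w R D Q M := by
  subst hB
  refine ⟨hD, ?_⟩
  have key : ∀ k i M', i + k = N.eval M → Agree (v :: P.modN) P.modR M M' → M'.nat v 0 0 = i →
      Inv i M' → loopWp (P.wp w R D) v k i Q M' := by
    intro k
    induction k with
    | zero =>
      intro i M' hi hM' _ h
      rw [add_zero] at hi
      subst hi
      exact hQ M' hM' h
    | succ k ih =>
      intro i M' hi hM' hv h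
      refine wp_conseq P (hs i (by omega) M' hM' hv h) fun M'' hM'' h'' =>
        ih (i + 1) _ (by omega) (hM'.trans (agree_setNat_cons hM'')) (by simp [Mem.setNat]) h''
  exact key _ _ _ (by simp) (agree_setNat_cons (Agree.refl _ _ _)) (by simp [Mem.setNat]) h0

theorem bits_setNat {M : Mem} {β : ℕ} (hM : M.Bits β) (a i j v : ℕ) (hv : Nat.size v ≤ β) :
    (M.setNat a i j v).Bits β := by
  intro b y z
  simp only [Mem.setNat]
  split_ifs
  · exact hv
  · exact hM b y z

theorem Bits.mono {M : Mem} {β β' : ℕ} (hM : M.Bits β) (h : β ≤ β') : M.Bits β' :=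
  fun a i j => (hM a i j).trans h

/-- Soundness of weakest preconditions, with running times. -/
theorem sound (P : Code) (hwf : P.wf = true) {Q : Mem → Prop} {M : Mem} (h : P.wp w R D Q M)
    {β K : ℕ} (hM : M.Bits β) (hK : 2 + β + P.work.eval D + R ≤ K) :
    ∃ M' t, Exec w P.toProg M M' t ∧ Q M' ∧ t ≤ P.work.eval D * K ∧
      M'.Bits (β + P.work.eval D) ∧ Agree P.modN P.modR M M' := by
  induction P generalizing Q M β with
  | skip =>
    refine ⟨M, 1, Exec.skip M, h, ?_, Bits.mono hM (by omega), Agree.refl _ _ _⟩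
    simp only [work, Polynomial.eval_one] at *; omega
  | setNat a i j x =>
    simp only [wf, Bool.and_eq_true] at hwf
    simp only [work, Polynomial.eval_C] at *
    have h1 := i.time_le hM hwf.1 (by omega : _ ≤ K)
    have h2 := j.time_le hM hwf.2.1 (by omega : _ ≤ K)
    have h3 := x.time_le hM hwf.2.2 (by omega : _ ≤ K)
    have h4 := x.size_eval_le hM hwf.2.2
    refine ⟨_, _, Exec.setNat a i j x M, h, ?_, ?_, agree_setNat _ _ _ _ _ _⟩
    · simp only [add_mul, one_mul]; omega
    · exact bits_setNat (Bits.mono hM (by omega)) _ _ _ _ (by omega)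
  | setReal a i j x =>
    simp only [wf, Bool.and_eq_true] at hwf
    simp only [work, Polynomial.eval_C] at *
    have h1 := i.time_le hM hwf.1 (by omega : _ ≤ K)
    have h2 := j.time_le hM hwf.2.1 (by omega : _ ≤ K)
    have h3 := x.time_le hM hwf.2.2 h.1 (by omega : _ ≤ K) (by omega)
    refine ⟨_, _, Exec.setReal a i j x M, h.2, ?_, ?_, agree_setReal _ _ _ _ _ _⟩
    · simp only [add_mul, one_mul]; omega
    · exact Bits.mono (β := β) (fun b y z => hM b y z) (by omega)
  | seq P P' ih ih' =>
    simp only [wf, Bool.and_eq_true] at hwf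
    simp only [work, Polynomial.eval_add] at *
    obtain ⟨M1, t1, e1, q1, l1, b1, a1⟩ := ih hwf.1 h hM (by omega)
    obtain ⟨M2, t2, e2, q2, l2, b2, a2⟩ := ih' hwf.2 q1 b1 (by omega)
    refine ⟨M2, _, Exec.seq _ _ _ _ _ _ _ e1 e2, q2, ?_, Bits.mono b2 (by omega), ?_⟩
    · rw [add_mul]; omega
    · exact (a1.mono (by simp [modN]) (by simp [modR])).trans
        (a2.mono (by simp [modN]) (by simp [modR]))
  | ite b P P' ih ih' =>
    simp only [wf, Bool.and_eq_true] at hwf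
    simp only [work, Polynomial.eval_add, Polynomial.eval_C] at *
    have hb := b.time_le hM hwf.1 h.1 (by omega : _ ≤ K) (by omega)
    by_cases hc : b.Holds M
    · obtain ⟨M1, t1, e1, q1, l1, b1, a1⟩ := ih hwf.2.1 (h.2.1 hc) hM (by omega)
      refine ⟨M1, _, Exec.ite_pos _ _ _ _ _ _ hc e1, q1, ?_, Bits.mono b1 (by omega), ?_⟩
      · simp only [add_mul, one_mul]; omega
      · exact a1.mono (by simp [modN]) (by simp [modR])
    · obtain ⟨M1, t1, e1, q1, l1, b1, a1⟩ := ih' hwf.2.2 (h.2.2 hc) hM (by omega)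
      refine ⟨M1, _, Exec.ite_neg _ _ _ _ _ _ hc e1, q1, ?_, Bits.mono b1 (by omega), ?_⟩
      · simp only [add_mul, one_mul]; omega
      · exact a1.mono (by simp [modN]) (by simp [modR])
  | rep v N P ih =>
    simp only [wf, Bool.and_eq_true, decide_eq_true_eq] at hwf
    obtain ⟨hN, hP, hv, hreads⟩ := hwf
    simp only [work, Polynomial.eval_add, Polynomial.eval_C, Polynomial.eval_mul,
      Polynomial.eval_X, Polynomial.eval_one] at *
    set W := P.work.eval D with hW
    set b := loopTest v N with hb
    set C := b.len + 20 + W with hC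
    have hbp : b.plain = true := by simp [hb, loopTest, BExp.plain, NExp.plain, hN]
    let inc : Prog := .setNat v (.const 0) (.const 0) (.add (.var v) (.const 1))
    -- The bit bound `β'` must vary: each round may lengthen numbers by `C` bits, and the `k`
    -- remaining rounds and the last test must still fit under `K`.
    have key : ∀ k i M' β', i + k = N.eval M → Agree (v :: P.modN) P.modR M M' →
        M'.nat v 0 0 = i → M'.Bits β' → loopWp (P.wp w R D) v k i Q M' →
        2 + β' + (k + 1) * C + R ≤ K →
        ∃ M'' t, Exec w (.loop b (.seq P.toProg inc)) M' M'' t ∧ Q M'' ∧ t ≤ (k + 1) * C * K ∧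
          M''.Bits (β' + (k + 1) * C) ∧ Agree (v :: P.modN) P.modR M M'' := by
      intro k
      induction k with
      | zero =>
        intro i M' β' hi ha hvi hbits hwp hK'
        have hNe : N.eval M' = N.eval M := N.eval_agree ha hreads
        have hnb : ¬ b.Holds M' := by
          simp only [hb, loopTest, BExp.Holds, NExp.eval, hvi, hNe]; omega
        have ht := b.time_le (w := w) hbits hbp trivial (by omega : _ ≤ K) (R := R) (by omega)
        refine ⟨M', _, Exec.loop_end _ _ _ hnb, hwp, ?_, Bits.mono hbits (by omega), ha⟩
        simp only [zero_add, one_mul, hC, add_mul]; omega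
      | succ k ihk =>
        intro i M' β' hi ha hvi hbits hwp hK'
        have hexp : (k + 1 + 1) * C = (k + 1) * C + C := by ring
        have hNe : N.eval M' = N.eval M := N.eval_agree ha hreads
        have hpb : b.Holds M' := by
          simp only [hb, loopTest, BExp.Holds, NExp.eval, hvi, hNe]; omega
        have ht := b.time_le (w := w) hbits hbp trivial (by omega : _ ≤ K) (R := R) (by omega)
        obtain ⟨M1, t1, e1, q1, l1, b1, a1⟩ := ih hP hwp hbits (by omega)
        have hv1 : M1.nat v 0 0 = i := by rw [a1.1 v hv, hvi]
        have hx : (NExp.add (.var v) (.const 1)).eval M1 = i + 1 := by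
          simp only [NExp.eval, hv1]
        have hinc : Exec w inc M1 (M1.setNat v 0 0 (i + 1))
            ((NExp.const 0).time M1 + (NExp.const 0).time M1
              + (NExp.add (.var v) (.const 1)).time M1 + 1) := by
          have := Exec.setNat (w := w) v (.const 0) (.const 0) (.add (.var v) (.const 1)) M1
          rw [hx] at this; exact this
        have hl : (NExp.add (.var v) (.const 1)).len = 6 := by
          simp [NExp.len, Nat.size_one]
        have hp0 : (NExp.add (.var v) (.const 1)).plain = true := rfl
        have ht1 := (NExp.const 0).time_le b1 rfl
          (by simp only [NExp.len, Nat.size_zero]; omega : _ ≤ K)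
        have ht2 := (NExp.add (.var v) (.const 1)).time_le b1 rfl (by rw [hl]; omega : _ ≤ K)
        have hsz := (NExp.add (.var v) (.const 1)).size_eval_le b1 rfl
        rw [hl] at ht2 hsz
        rw [hx] at hsz
        simp only [NExp.len, Nat.size_zero] at ht1
        have b2 : (M1.setNat v 0 0 (i + 1)).Bits (β' + C) :=
          bits_setNat (Bits.mono b1 (by omega)) _ _ _ _ (by omega)
        obtain ⟨M2, t2, e2, q2, l2, b3, a2⟩ := ihk (i + 1) (M1.setNat v 0 0 (i + 1)) (β' + C)
          (by omega) (ha.trans (agree_setNat_cons a1)) (by simp [Mem.setNat]) b2 q1 (by omega)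
        refine ⟨M2, _, Exec.loop_step _ _ _ _ _ _ _ hpb (Exec.seq _ _ _ _ _ _ _ e1 hinc) e2, q2,
          ?_, Bits.mono b3 (by omega), a2⟩
        rw [hexp, add_mul]
        have hCK : C * K = b.len * K + 20 * K + W * K := by rw [hC]; ring
        rw [hCK]
        omega
    have hle : (N.eval M + 1) * C ≤ (D + 1) * C := Nat.mul_le_mul_right _ (by have := h.1; omega)
    have hinit : Exec w (.setNat v (.const 0) (.const 0) (.const 0)) M (M.setNat v 0 0 0) 4 :=
      Exec.setNat (w := w) v (.const 0) (.const 0) (.const 0) M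
    obtain ⟨M1, t1, e1, q1, l1, b1, a1⟩ := key (N.eval M) 0 (M.setNat v 0 0 0) β (by omega)
      (agree_setNat_cons (Agree.refl _ _ _)) (by simp [Mem.setNat])
      (bits_setNat hM _ _ _ _ (by simp)) h.2 (by omega)
    refine ⟨M1, _, Exec.seq _ _ _ _ _ _ _ hinit e1, q1, ?_, Bits.mono b1 (by omega), a1⟩
    have : (N.eval M + 1) * C * K ≤ (D + 1) * C * K := Nat.mul_le_mul_right _ hle
    rw [add_mul]; omega

end Code


/-! ### Scanning for a minimum -/

section Scan
open Classical in
/-- Scanning `0, …, N - 1` for a `p`-element that is minimal with respect to `le`: its successor, or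
`0` if there is none. -/
noncomputable def scanMin (p : ℕ → Prop) (le : ℕ → ℕ → Prop) : ℕ → ℕ
  | 0 => 0
  | i + 1 =>
    if p i ∧ (scanMin p le i = 0 ∨ le i (scanMin p le i - 1)) then i + 1 else scanMin p le i

variable {p : ℕ → Prop} {le : ℕ → ℕ → Prop}

theorem scanMin_le (N : ℕ) : scanMin p le N ≤ N := by
  induction N with
  | zero => simp [scanMin]
  | succ i ih => simp only [scanMin]; split_ifs <;> omega

theorem scanMin_mem {N b : ℕ} (h : scanMin p le N = b + 1) : p b := by
  induction N with
  | zero => simp [scanMin] at h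
  | succ i ih =>
    simp only [scanMin] at h
    split_ifs at h with hc
    · obtain rfl : i = b := by omega
      exact hc.1
    · exact ih h

theorem scanMin_eq_zero {N : ℕ} : scanMin p le N = 0 ↔ ∀ i < N, ¬ p i := by
  induction N with
  | zero => simp [scanMin]
  | succ i ih =>
    simp only [scanMin]
    constructor
    · intro h
      split_ifs at h with hc
      intro j hj
      rcases Nat.lt_succ_iff_lt_or_eq.1 hj with h' | rfl
      · exact ih.1 h j h'
      · exact fun hp => hc ⟨hp, Or.inl h⟩
    · intro h
      rw [if_neg fun hc => h i (by omega) hc.1]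
      exact ih.2 fun j hj => h j (by omega)

/-- The comparison needs to reflect the key on candidates only: the greedy test multiplies out
ratios, which is legitimate only where the denominators are positive. -/
theorem scanMin_min {key : ℕ → ℝ} (hkey : ∀ i b, p i → p b → (le i b ↔ key i ≤ key b))
    {N b : ℕ} (h : scanMin p le N = b + 1) : ∀ i < N, p i → key b ≤ key i := by
  induction N generalizing b with
  | zero => simp [scanMin] at h
  | succ i ih =>
    simp only [scanMin] at h
    intro j hj hpj
    split_ifs at h with hc
    · obtain rfl : i = b := by omega
      rcases Nat.lt_succ_iff_lt_or_eq.1 hj with h' | rfl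
      · rcases hc.2 with h0 | hle
        · exact absurd hpj (scanMin_eq_zero.1 h0 j h')
        · obtain ⟨b', hb'⟩ : ∃ b', scanMin p le i = b' + 1 := by
            refine Nat.exists_eq_succ_of_ne_zero fun h0 => ?_
            exact absurd hpj (scanMin_eq_zero.1 h0 j h')
          rw [hb', Nat.add_sub_cancel] at hle
          exact ((hkey _ _ hc.1 (scanMin_mem hb')).1 hle).trans (ih hb' j h' hpj)
      · exact le_rfl
    · rcases Nat.lt_succ_iff_lt_or_eq.1 hj with h' | rfl
      · exact ih h j h' hpj
      · by_contra hlt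
        refine hc ⟨hpj, Or.inr ?_⟩
        rw [h, Nat.add_sub_cancel]
        exact (hkey _ _ hpj (scanMin_mem h)).2 (not_le.1 hlt).le

end Scan

/-! ### Scans as code -/

namespace Code

variable {w : ℝ → ℕ} {R D : ℕ}

/-- Array `10` receives the result of scanning `0, …, N - 1`; the tests may read the candidate from
array `25` and (one plus) the best candidate so far from array `10`. -/
def amin (N : NExp) (cand le : BExp) : Code :=
  .seq (.setNat 10 (.const 0) (.const 0) (.const 0))
    -- The disjunction "no candidate yet, or at least as good" is written with negation and
    -- conjunction.
    (.rep 25 N (.ite (.and cand (.not (.and (.not (.natLe (.var 10) (.const 0))) (.not le))))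
      (.setNat 10 (.const 0) (.const 0) (.add (.var 25) (.const 1))) .skip))

theorem wp_amin {N : NExp} {cand lt : BExp} {M : Mem} {B : ℕ} (p : ℕ → Prop) (le : ℕ → ℕ → Prop)
    (hN : ∀ M', Agree [25, 10] [] M M' → N.eval M' = B) (hB : B ≤ D)
    (hc : ∀ M', Agree [25, 10] [] M M' → ∀ i < B, M'.nat 25 0 0 = i →
      cand.Ok w R M' ∧ (cand.Holds M' ↔ p i))
    (hl : ∀ M', Agree [25, 10] [] M M' → ∀ i < B, ∀ b < B, M'.nat 25 0 0 = i →
      M'.nat 10 0 0 - 1 = b → lt.Ok w R M' ∧ (lt.Holds M' ↔ le i b)) :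
    (amin N cand lt).wp w R D (fun M' => M'.nat 10 0 0 = scanMin p le B) M := by
  have h10 := agree_setNat M 10 0 0 0 []
  refine wp_rep (fun i M' => M'.nat 10 0 0 = scanMin p le i)
    (hN _ (h10.mono (by simp) (by simp))) hB ?_ ?_ fun _ _ h => h
  · simp [Mem.setNat, scanMin, NExp.eval]
  · intro i hi M' hM' hv hInv
    have hag : Agree [25, 10] [] M M' :=
      (h10.mono (by simp) (by simp)).trans (hM'.mono (by simp [modN]) (by simp [modR]))
    obtain ⟨hc1, hc2⟩ := hc M' hag i hi hv
    have hb := scanMin_le (p := p) (le := le) i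
    -- Before the first candidate, `0 - 1 = 0` serves as a dummy index: the comparison is still
    -- evaluated and charged, but its outcome is irrelevant.
    obtain ⟨hl1, hl2⟩ := hl M' hag i hi (scanMin p le i - 1) (by omega) hv (by rw [hInv])
    have hiff :
        (BExp.and cand (.not (.and (.not (.natLe (.var 10) (.const 0))) (.not lt)))).Holds M'
        ↔ p i ∧ (scanMin p le i = 0 ∨ le i (scanMin p le i - 1)) := by
      simp only [BExp.Holds, NExp.eval, hc2, hl2, hInv, Nat.le_zero]
      tauto
    refine ⟨⟨hc1, trivial, hl1⟩, fun h => ?_, fun h => ?_⟩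
    · rw [hiff] at h
      simp only [wp, Mem.setNat, NExp.eval, scanMin, hv, if_pos h]
      simp
    · rw [hiff] at h
      simp only [wp, Mem.setNat, scanMin, if_neg h]
      simp [hInv]

/-- Array `a` receives the results of a scan for every value `< N` of the counter `v`. -/
def tab (a v : ℕ) (N B : NExp) (cand le : BExp) : Code :=
  .rep v N (.seq (amin B cand le) (.setNat a (.var v) (.const 0) (.var 10)))

theorem wp_tab {a v : ℕ} {N Bx : NExp} {cand lt : BExp} {M : Mem} {n B : ℕ} (p : ℕ → ℕ → Prop)
    (le : ℕ → ℕ → ℕ → Prop) (hN : N.eval (M.setNat v 0 0 0) = n ∧ N.eval M = n) (hn : n ≤ D)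
    (hBx : ∀ M', Agree [v, 25, 10, a] [] M M' → Bx.eval M' = B) (hB : B ≤ D)
    (ha : a ∉ [v, 25, 10]) (hv : v ∉ [25, 10])
    (hc : ∀ M', Agree [v, 25, 10, a] [] M M' → ∀ e < n, ∀ i < B, M'.nat v 0 0 = e →
      M'.nat 25 0 0 = i → cand.Ok w R M' ∧ (cand.Holds M' ↔ p e i))
    (hl : ∀ M', Agree [v, 25, 10, a] [] M M' → ∀ e < n, ∀ i < B, ∀ b < B, M'.nat v 0 0 = e →
      M'.nat 25 0 0 = i → M'.nat 10 0 0 - 1 = b → lt.Ok w R M' ∧ (lt.Holds M' ↔ le e i b)) :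
    (tab a v N Bx cand lt).wp w R D
      (fun M' => ∀ e < n, M'.nat a e 0 = scanMin (p e) (le e) B) M := by
  simp only [List.mem_cons, List.not_mem_nil, or_false, not_or] at ha hv
  refine wp_rep (fun j M' => ∀ e < j, M'.nat a e 0 = scanMin (p e) (le e) B) hN.2 hn ?_ ?_
    fun _ _ h => h
  · intro e he; omega
  · intro j hj M' hM' hvj hInv
    have hag : Agree [v, 25, 10, a] [] M M' :=
      hM'.mono (by simp [modN, amin]) (by simp [modR, amin])
    have hag' : ∀ M'', Agree [25, 10] [] M' M'' → Agree [v, 25, 10, a] [] M M'' :=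
      fun M'' h => hag.trans (h.mono (by simp) (by simp))
    have hv'' : ∀ M'', Agree [25, 10] [] M' M'' → M''.nat v 0 0 = j := fun M'' h => by
      rw [h.1 v (by simp [hv.1, hv.2]), hvj]
    refine wp_conseq (amin Bx cand lt) (wp_amin (p j) (le j) (fun M'' h => hBx M'' (hag' M'' h)) hB
      (fun M'' h i hi h25 => hc M'' (hag' M'' h) j hj i hi (hv'' M'' h) h25)
      (fun M'' h i hi b hb h25 h10 => hl M'' (hag' M'' h) j hj i hi b hb (hv'' M'' h) h25 h10)) ?_
    intro M1 hM1 h1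
    have hM1' : Agree [25, 10] [] M' M1 := hM1.mono (by simp [modN, amin]) (by simp [modR, amin])
    have hv1 := hv'' M1 hM1'
    have ha1 : M1.nat a = M'.nat a := hM1'.1 a (by simp [ha.2.1, ha.2.2])
    intro e he
    simp only [NExp.eval, hv1, Mem.setNat, h1]
    by_cases hej : e = j
    · subst hej; simp [ha.1]
    · simp only [hej, false_and, and_false, if_false, ha.1]
      rw [ha1]; exact hInv e (by omega)

end Code

/-! ### The algorithm as a function of the instance -/

namespace Problem

variable (I : Problem)

/-- Membership, for indices that are natural numbers. -/
def inS (s e : ℕ) : Prop := ∃ (hs : s < I.m) (he : e < I.n), (⟨e, he⟩ : Fin I.n) ∈ I.S ⟨s, hs⟩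

/-- The cost of the set with a natural number as index. -/
noncomputable def cs (s : ℕ) : ℝ := if hs : s < I.m then I.c ⟨s, hs⟩ else 0

/-- The inflation factor of a day given as a natural number. -/
noncomputable def lamN (j : ℕ) : ℝ := if hj : j < I.T + 1 then I.lam ⟨j, hj⟩ else 0

/-- The cardinality bound of a day given as a natural number. -/
def kN (j : ℕ) : ℕ := if hj : j < I.T + 1 then I.k ⟨j, hj⟩ else 0

/-- One plus the index of a cheapest set containing `e`. -/
noncomputable def fN (e : ℕ) : ℕ := scanMin (fun s => I.inS s e) (fun s b => I.cs s ≤ I.cs b) I.m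

/-- The cost of a cheapest set containing `e`. -/
noncomputable def mc (e : ℕ) : ℝ := I.cs (I.fN e - 1)

/-- One plus the second day of action. -/
noncomputable def dN : ℕ :=
  scanMin (fun _ => True) (fun j b => I.lamN j * I.kN j ≤ I.lamN b * I.kN b) (I.T + 1)

/-- The net for the threshold `mc q`; empty if `q = n`. -/
noncomputable def netQ (q : ℕ) : Finset (Fin I.n) :=
  open Classical in Finset.univ.filter fun e => q < I.n ∧ I.mc q ≤ I.mc e

open Classical in
/-- The number of elements of the net that `s` covers newly. -/
noncomputable def cnt (q : ℕ) (G : Finset (Fin I.m)) (s : ℕ) : ℕ :=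
  (Finset.filter (fun e : Fin I.n => I.inS s e) (I.netQ q \ I.cov G)).card

/-- One plus the next greedy choice. -/
noncomputable def pick (q : ℕ) (G : Finset (Fin I.m)) : ℕ :=
  scanMin (fun s => 0 < I.cnt q G s)
    -- Costs per newly covered element are compared by cross-multiplication, as the machine does not
    -- divide.
    (fun s b => I.cs s * I.cnt q G b ≤ I.cs b * I.cnt q G s) I.m

/-- One greedy step. -/
noncomputable def pickStep (q : ℕ) (G : Finset (Fin I.m)) : Finset (Fin I.m) :=
  if h : 0 < I.pick q G ∧ I.pick q G - 1 < I.m then insert ⟨I.pick q G - 1, h.2⟩ G else G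

/-- The greedy collection after `t` steps. -/
noncomputable def gr (q : ℕ) : ℕ → Finset (Fin I.m)
  | 0 => ∅
  | t + 1 => I.pickStep q (gr q t)

/-- One plus an element outside the net that is most expensive to cover. -/
noncomputable def worst (q : ℕ) : ℕ :=
  scanMin (fun e => ¬ (q < I.n ∧ I.mc q ≤ I.mc e)) (fun e b => I.mc b ≤ I.mc e) I.n

/-- The bound on the worst-case cost of the thrifty strategy for the threshold `mc q`. -/
noncomputable def val (q : ℕ) : ℝ :=
  ∑ s ∈ I.gr q I.n, I.c s +
    -- At most `k` elements are active on the second day of action, and those left uncovered lie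
    -- outside the net.
    if I.worst q = 0 then 0 else I.lamN (I.dN - 1) * I.kN (I.dN - 1) * I.mc (I.worst q - 1)

/-- One plus the best threshold. -/
noncomputable def best : ℕ := scanMin (fun _ => True) (fun q b => I.val q ≤ I.val b) (I.n + 1)

/-- The real numbers computed by the algorithm have size at most `R`. -/
structure Sized (w : ℝ → ℕ) (R : ℕ) : Prop where
  cs : ∀ s, w (I.cs s) ≤ R
  lam : ∀ j, w (I.lamN j) ≤ R
  nat : ∀ a ≤ I.n, w a ≤ R
  cs_mul : ∀ s, ∀ a ≤ I.n, w (I.cs s * a) ≤ R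
  lam_mul : ∀ j, w (I.lamN j * I.kN j) ≤ R
  lam_mul_cs : ∀ j s, w (I.lamN j * I.kN j * I.cs s) ≤ R
  sum : ∀ G : Finset (Fin I.m), w (∑ s ∈ G, I.c s) ≤ R
  sum_add : ∀ (G : Finset (Fin I.m)) j s, w (∑ s ∈ G, I.c s + I.lamN j * I.kN j * I.cs s) ≤ R

open Classical in
/-- The memory contains the instance. -/
structure Base (M : Mem) : Prop where
  n : M.nat 0 0 0 = I.n
  m : M.nat 0 1 0 = I.m
  T : M.nat 0 2 0 = I.T
  k : ∀ j, M.nat 1 j 0 = I.kN j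
  S : ∀ s e, M.nat 2 s e = if I.inS s e then 1 else 0
  c : ∀ s, M.real 0 s 0 = I.cs s
  lam : ∀ j, M.real 1 j 0 = I.lamN j

variable {I}

theorem Base.agree {M M' : Mem} {a r : List ℕ} (h : I.Base M) (hM : Agree a r M M')
    (ha : 0 ∉ a ∧ 1 ∉ a ∧ 2 ∉ a) (hr : 0 ∉ r ∧ 1 ∉ r) : I.Base M' where
  n := by rw [hM.1 0 ha.1, h.n]
  m := by rw [hM.1 0 ha.1, h.m]
  T := by rw [hM.1 0 ha.1, h.T]
  k j := by rw [hM.1 1 ha.2.1, h.k]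
  S s e := by rw [hM.1 2 ha.2.2, h.S]
  c s := by rw [hM.2 0 hr.1, h.c]
  lam j := by rw [hM.2 1 hr.2, h.lam]

theorem kN_le (j : ℕ) : I.kN j ≤ I.n := by
  unfold kN; split_ifs
  · exact I.k_le _
  · exact Nat.zero_le _

theorem cnt_le (q : ℕ) (G : Finset (Fin I.m)) (s : ℕ) : I.cnt q G s ≤ I.n := by
  unfold cnt; exact (Finset.card_le_univ _).trans (by simp)

end Problem


/-! ### The program -/

/-- Entry `(i, 0)` of the array `a`. -/
abbrev NExp.at1 (a : ℕ) (i : NExp) : NExp := .get a i (.const 0)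

/-- Predecessor. -/
abbrev NExp.pred (x : NExp) : NExp := .sub x (.const 1)

/-- The truth. -/
def BExp.tt : BExp := .natLe (.const 0) (.const 0)

namespace Code

/-- The size of the universe. -/
abbrev nX : NExp := .var 0
/-- The number of sets. -/
abbrev mX : NExp := .get 0 (.const 1) (.const 0)
/-- The number of stages. -/
abbrev tX : NExp := .get 0 (.const 2) (.const 0)
/-- The day. -/
abbrev dayX : NExp := .get 0 (.const 3) (.const 0)
/-- The best candidate of a scan. -/
abbrev bestX : NExp := .pred (.var 10)

/-- Set `s` contains element `e`. -/
def hasX (s e : NExp) : BExp := .natLe (.const 1) (.get 2 s e)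
/-- The cost of set `s`. -/
def costX (s : NExp) : RExp := .get 0 s (.const 0)
/-- The cost of the cheapest set containing `e`. -/
def mcX (e : NExp) : RExp := costX (.pred (.at1 5 e))
/-- The product of inflation factor and cardinality bound on day `j`. -/
def lamkX (j : NExp) : RExp := .mul (.get 1 j (.const 0)) (.ofNat (.at1 1 j))
/-- Element `e` is in the net for the threshold whose index is in array `23`. -/
def netX (e : NExp) : BExp :=
  .and (.natLe (.add (.var 23) (.const 1)) nX) (.realLe (mcX (.var 23)) (mcX e))

/-- Array `5` receives the cheapest sets. -/
def minSets : Code := tab 5 20 nX mX (hasX (.var 25) (.var 20))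
  (.realLe (costX (.var 25)) (costX bestX))

/-- Array `6` receives the second day of action. -/
def minDay : Code := .seq
  (amin (.add tX (.const 1)) .tt (.realLe (lamkX (.var 25)) (lamkX bestX)))
  (.setNat 6 (.const 0) (.const 0) (.var 10))

/-- Array `7` marks the elements covered by the sets marked in array `8`. -/
def covered : Code := tab 7 20 nX mX
  (.and (.natLe (.const 1) (.at1 8 (.var 25))) (hasX (.var 25) (.var 20))) .tt

/-- Array `9` counts the net elements that a set covers newly. -/
def count : Code := .rep 21 mX (.seq (.setNat 9 (.var 21) (.const 0) (.const 0))
  (.rep 20 nX (.ite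
    (.and (hasX (.var 21) (.var 20)) (.and (netX (.var 20)) (.natLe (.at1 7 (.var 20)) (.const 0))))
    (.setNat 9 (.var 21) (.const 0) (.add (.at1 9 (.var 21)) (.const 1))) .skip)))

/-- One greedy choice. -/
def choose : Code := .seq
  (amin mX (.natLe (.const 1) (.at1 9 (.var 25)))
    (.realLe (.mul (costX (.var 25)) (.ofNat (.at1 9 bestX)))
      (.mul (costX bestX) (.ofNat (.at1 9 (.var 25))))))
  (.ite (.natLe (.const 1) (.var 10))
    (.seq (.setNat 8 bestX (.const 0) (.const 1))
      (.setReal 3 (.const 0) (.const 0) (.add (.get 3 (.const 0) (.const 0)) (costX bestX))))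
    .skip)

/-- Array `8` receives the greedy collection for the net, and real array `3` its cost. -/
def greedy : Code := .seq (.rep 21 mX (.setNat 8 (.var 21) (.const 0) (.const 0)))
  (.seq (.setReal 3 (.const 0) (.const 0) (.ofNat (.const 0)))
    (.rep 24 nX (.seq covered (.seq count choose))))

/-- Real array `2` receives the value of the threshold whose index is in array `23`. -/
def value : Code := .seq greedy
  (.seq (amin nX (.not (netX (.var 25))) (.realLe (mcX bestX) (mcX (.var 25))))
    (.ite (.natLe (.const 1) (.var 10))
      (.setReal 2 (.var 23) (.const 0) (.add (.get 3 (.const 0) (.const 0))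
        (.mul (lamkX (.pred (.var 6))) (mcX bestX))))
      (.setReal 2 (.var 23) (.const 0) (.get 3 (.const 0) (.const 0)))))

/-- Array `23` receives the best threshold. -/
def threshold : Code := .seq (.rep 23 (.add nX (.const 1)) value)
  (.seq (amin (.add nX (.const 1)) .tt
      (.realLe (.get 2 (.var 25) (.const 0)) (.get 2 bestX (.const 0))))
    (.setNat 23 (.const 0) (.const 0) bestX))

/-- Array `14` marks the inactive elements. -/
def inactive : Code := tab 14 20 nX (.add dayX (.const 1))
  (.natLe (.get 3 (.var 25) (.var 20)) (.const 0)) .tt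

/-- The output of the collection bought on day `0`. -/
def outGreedy : Code := .ite (.natLe dayX (.const 0))
  (.rep 21 mX (.ite (.natLe (.const 1) (.at1 8 (.var 21)))
    (.setNat 4 (.var 21) (.const 0) (.const 1)) .skip)) .skip

/-- The output of the cheapest sets of the active uncovered elements. -/
def outMinSets : Code := .ite
  (.and (.natLe (.add dayX (.const 1)) (.var 6)) (.natLe (.var 6) (.add dayX (.const 1))))
  (.rep 20 nX (.ite (.and (.natLe (.at1 14 (.var 20)) (.const 0))
      (.natLe (.at1 7 (.var 20)) (.const 0)))
    (.setNat 4 (.pred (.at1 5 (.var 20))) (.const 0) (.const 1)) .skip)) .skip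

/-- The algorithm. -/
def main : Code := .seq minSets (.seq minDay (.seq threshold (.seq greedy (.seq covered
  (.seq inactive (.seq outGreedy outMinSets))))))

theorem main_wf : main.wf = true := by decide

end Code

/-! ### Correctness of the subprograms -/

namespace Problem

open Code

variable {I : Problem} {w : ℝ → ℕ} {R D : ℕ}

theorem wp_minSets (hw : I.Sized w R) (hD : I.n + I.m + I.T + 1 ≤ D) {M : Mem} (hM : I.Base M) :
    minSets.wp w R D (fun M' => ∀ e < I.n, M'.nat 5 e 0 = I.fN e) M := by
  have hb : ∀ M', Agree [20, 25, 10, 5] [] M M' → I.Base M' := fun M' h =>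
    hM.agree h (by decide) (by decide)
  refine wp_tab (fun e s => I.inS s e) (fun _ s b => I.cs s ≤ I.cs b) (n := I.n) (B := I.m)
    ?_ (by omega) ?_ (by omega) (by decide) (by decide) ?_ ?_
  · simp [NExp.eval, Mem.setNat, hM.n]
  · intro M' h; simp [NExp.eval, (hb M' h).m]
  · intro M' h e _ s _ he hs
    refine ⟨trivial, ?_⟩
    simp only [hasX, BExp.Holds, NExp.eval, hs, he, (hb M' h).S]
    split_ifs with h1 <;> simp [h1]
  · intro M' h e _ s _ b _ he hs hbb
    simp [BExp.Holds, BExp.Ok, RExp.Ok, RExp.eval, costX, NExp.eval, hs, hbb, (hb M' h).c, hw.cs]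

theorem wp_minDay (hw : I.Sized w R) (hD : I.n + I.m + I.T + 1 ≤ D) {M : Mem} (hM : I.Base M) :
    minDay.wp w R D (fun M' => M'.nat 6 0 0 = I.dN) M := by
  have hb : ∀ M', Agree [25, 10] [] M M' → I.Base M' := fun M' h =>
    hM.agree h (by decide) (by decide)
  refine wp_conseq (amin _ _ _) (wp_amin (fun _ => True)
    (fun j b => I.lamN j * I.kN j ≤ I.lamN b * I.kN b) (B := I.T + 1) ?_ (by omega) ?_ ?_) ?_
  · intro M' h; simp [NExp.eval, (hb M' h).T]
  · intro M' h i _ _; simp [BExp.tt, BExp.Ok, BExp.Holds, NExp.eval]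
  · intro M' h j _ b _ hj hbb
    have h1 : ∀ j, w (I.kN j : ℝ) ≤ R := fun j => hw.nat _ (kN_le j)
    simp [BExp.Holds, BExp.Ok, RExp.Ok, RExp.eval, lamkX, NExp.eval, hj, hbb, (hb M' h).lam,
      (hb M' h).k, hw.lam, hw.lam_mul, h1]
  · intro M' _ h
    change M'.nat 10 0 0 = I.dN at h
    simpa [wp, Mem.setNat, NExp.eval] using h

/-- The cheapest sets and the index of a threshold are in memory. -/
structure Ready (I : Problem) (q : ℕ) (M : Mem) : Prop where
  base : I.Base M
  f : ∀ e < I.n, M.nat 5 e 0 = I.fN e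
  q : M.nat 23 0 0 = q

theorem Ready.agree {q : ℕ} {M M' : Mem} {a r : List ℕ} (h : I.Ready q M) (hM : Agree a r M M')
    (ha : (0 ∉ a ∧ 1 ∉ a ∧ 2 ∉ a) ∧ 5 ∉ a ∧ 23 ∉ a) (hr : 0 ∉ r ∧ 1 ∉ r) : I.Ready q M' where
  base := h.base.agree hM ha.1 hr
  f e he := by rw [hM.1 5 ha.2.1, h.f e he]
  q := by rw [hM.1 23 ha.2.2, h.q]

theorem Ready.net_ok {q : ℕ} {M : Mem} (h : I.Ready q M) (hw : I.Sized w R) (x : NExp) :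
    (netX x).Ok w R M := by
  simp [netX, mcX, costX, BExp.Ok, RExp.Ok, RExp.eval, NExp.eval, h.base.c, hw.cs]

theorem Ready.net_holds {q : ℕ} {M : Mem} (h : I.Ready q M) (x : NExp) (hx : x.eval M < I.n) :
    (netX x).Holds M ↔ q < I.n ∧ I.mc q ≤ I.mc (x.eval M) := by
  simp only [netX, mcX, costX, BExp.Holds, RExp.eval, NExp.eval, h.base.c, h.base.n, h.q,
    h.f _ hx, Nat.succ_le_iff]
  -- Array `5` is filled only below `n`; for `q = n` the first test fails, so the value read there
  -- does not matter.
  refine and_congr_right fun hq => ?_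
  rw [h.f q hq, mc, mc]

/-- The collection `G` is marked in array `8`. -/
def Marks (G : Finset (Fin I.m)) (M : Mem) : Prop :=
  ∀ s : Fin I.m, M.nat 8 s 0 = if s ∈ G then 1 else 0

/-- A scan used as a search: its result is `0` exactly when no marked set contains the element, so
the comparison may be trivial. -/
theorem wp_covered (hD : I.n + I.m + I.T + 1 ≤ D) {M : Mem} (hM : I.Base M)
    {G : Finset (Fin I.m)} (hG : Marks G M) :
    covered.wp w R D (fun M' => ∀ e : Fin I.n, M'.nat 7 e 0 = 0 ↔ e ∉ I.cov G) M := by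
  have hb : ∀ M', Agree [20, 25, 10, 7] [] M M' → I.Base M' := fun M' h =>
    hM.agree h (by decide) (by decide)
  refine wp_conseq _ (wp_tab (fun e s => (∃ h : s < I.m, (⟨s, h⟩ : Fin I.m) ∈ G) ∧ I.inS s e)
    (fun _ _ _ => True) (n := I.n) (B := I.m)
    ?_ (by omega) ?_ (by omega) (by decide) (by decide) ?_ ?_) ?_
  · simp [NExp.eval, Mem.setNat, hM.n]
  · intro M' h; simp [NExp.eval, (hb M' h).m]
  · intro M' h e _ s hsm he hs
    refine ⟨⟨trivial, trivial⟩, ?_⟩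
    have h8 : M'.nat 8 = M.nat 8 := h.1 8 (by decide)
    have h9 := hG ⟨s, hsm⟩
    simp only at h9
    simp only [hasX, BExp.Holds, NExp.eval, hs, he, (hb M' h).S, h8, h9, hsm, exists_true_left]
    refine and_congr ?_ ?_
    · split_ifs with h1 <;> simp [h1]
    · split_ifs with h1 <;> simp [h1]
  · intro M' _ e _ s _ b _ _ _ _
    simp [BExp.tt, BExp.Ok, BExp.Holds, NExp.eval]
  · intro M' _ h e
    rw [h e e.isLt, scanMin_eq_zero]
    simp only [cov, Finset.mem_biUnion, not_exists, not_and, inS]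
    constructor
    · intro h' s hs he
      exact h' s s.isLt ⟨s.isLt, hs⟩ s.isLt e.isLt he
    · rintro h' s hs ⟨_, hG'⟩ _ _ he
      exact h' _ hG' he

/-- The contribution of the elements below `i` to `cnt`. -/
noncomputable def cntTo (I : Problem) (q : ℕ) (G : Finset (Fin I.m)) (s i : ℕ) : ℕ :=
  open Classical in
  Finset.card (Finset.filter (fun e : Fin I.n => e.val < i ∧ I.inS s e) (I.netQ q \ I.cov G))

theorem cntTo_zero (q : ℕ) (G : Finset (Fin I.m)) (s : ℕ) : I.cntTo q G s 0 = 0 := by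
  simp [cntTo]

theorem cntTo_n (q : ℕ) (G : Finset (Fin I.m)) (s : ℕ) : I.cntTo q G s I.n = I.cnt q G s := by
  unfold cntTo cnt
  congr 1
  ext e
  simp only [Finset.mem_filter, e.isLt, true_and]

theorem cntTo_succ (q : ℕ) (G : Finset (Fin I.m)) (s : ℕ) (i : Fin I.n) [Decidable
    (I.inS s i ∧ i ∈ I.netQ q \ I.cov G)] :
    I.cntTo q G s (i + 1) = I.cntTo q G s i
      + if I.inS s i ∧ i ∈ I.netQ q \ I.cov G then 1 else 0 := by
  classical
  unfold cntTo
  split_ifs with h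
  · rw [← Finset.card_insert_of_notMem (a := i) (by simp)]
    congr 1
    ext e
    simp only [Finset.mem_filter, Finset.mem_insert]
    constructor
    · rintro ⟨h1, h2, h3⟩
      rcases Nat.lt_succ_iff_lt_or_eq.1 h2 with h4 | h4
      · exact Or.inr ⟨h1, h4, h3⟩
      · exact Or.inl (Fin.ext h4)
    · rintro (rfl | ⟨h1, h2, h3⟩)
      · exact ⟨h.2, by omega, h.1⟩
      · exact ⟨h1, by omega, h3⟩
  · rw [add_zero]
    congr 1
    ext e
    simp only [Finset.mem_filter]
    constructor
    · rintro ⟨h1, h2, h3⟩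
      rcases Nat.lt_succ_iff_lt_or_eq.1 h2 with h4 | h4
      · exact ⟨h1, h4, h3⟩
      · obtain rfl := Fin.ext h4
        exact absurd ⟨h3, h1⟩ h
    · rintro ⟨h1, h2, h3⟩
      exact ⟨h1, by omega, h3⟩

theorem wp_count (hw : I.Sized w R) (hD : I.n + I.m + I.T + 1 ≤ D) {q : ℕ} {M : Mem}
    (hM : I.Ready q M) {G : Finset (Fin I.m)}
    (hc : ∀ e : Fin I.n, M.nat 7 e 0 = 0 ↔ e ∉ I.cov G) :
    count.wp w R D (fun M' => ∀ s < I.m, M'.nat 9 s 0 = I.cnt q G s) M := by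
  classical
  refine wp_rep (fun i M' => ∀ s < i, M'.nat 9 s 0 = I.cnt q G s) (B := I.m)
    (by simp [NExp.eval, hM.base.m]) (by omega) (by simp) ?_ fun _ _ h => h
  intro s hs M1 hA1 hv1 hI1
  have hR1 : I.Ready q M1 := hM.agree hA1 (by decide) (by decide)
  refine wp_rep (fun i M' => M'.nat 9 s 0 = I.cntTo q G s i ∧
    ∀ s' < s, M'.nat 9 s' 0 = I.cnt q G s') (B := I.n) ?_ (by omega) ?_ ?_ ?_
  · simp [NExp.eval, Mem.setNat, hR1.base.n]
  · simp only [NExp.eval, Mem.setNat, hv1, cntTo_zero]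
    refine ⟨by simp, fun s' hs' => ?_⟩
    simp [hs'.ne, hI1 s' hs']
  · intro e he M2 hA2 hv2 hI2
    have hA2' : Agree [20, 9] [] M1 M2 :=
      ((agree_setNat M1 9 _ _ _ []).mono (by simp) (by simp)).trans
        (hA2.mono (by simp [modN]) (by simp [modR]))
    have hR2 : I.Ready q M2 := hR1.agree hA2' (by decide) (by decide)
    have h7 : M2.nat 7 = M.nat 7 := (hA2'.1 7 (by decide)).trans (hA1.1 7 (by decide))
    have h21 : M2.nat 21 0 0 = s := by rw [hA2'.1 21 (by decide), hv1]
    have hx : (NExp.var 20).eval M2 = e := by simp [NExp.eval, hv2]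
    have hiff : (BExp.and (hasX (.var 21) (.var 20)) (.and (netX (.var 20))
        (.natLe (.at1 7 (.var 20)) (.const 0)))).Holds M2
        ↔ I.inS s e ∧ (⟨e, he⟩ : Fin I.n) ∈ I.netQ q \ I.cov G := by
      have h1 := hR2.net_holds (.var 20) (by rw [hx]; exact he)
      rw [hx] at h1
      have h2 := hc ⟨e, he⟩
      simp only at h2
      simp only [BExp.Holds, h1, hasX, NExp.eval, hR2.base.S, h21, hv2, h7, Nat.le_zero, h2,
        Finset.mem_sdiff, netQ, Finset.mem_filter, Finset.mem_univ, true_and]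
      refine and_congr ?_ Iff.rfl
      split_ifs with h1 <;> simp [h1]
    have hsucc := cntTo_succ q G s ⟨e, he⟩
    simp only at hsucc
    refine ⟨⟨trivial, hR2.net_ok hw _, trivial⟩, fun h => ?_, fun h => ?_⟩
    · rw [hiff] at h
      rw [if_pos h] at hsucc
      simp only [wp, Mem.setNat, NExp.eval, h21, hsucc, hI2.1]
      refine ⟨by simp, fun s' hs' => ?_⟩
      simp [hs'.ne, hI2.2 s' hs']
    · rw [hiff] at h
      rw [if_neg h] at hsucc
      simp only [wp, Mem.setNat, hsucc, hI2.1]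
      refine ⟨by simp, fun s' hs' => ?_⟩
      simp [hI2.2 s' hs']
  · intro M2 _ hI2 s' hs'
    simp only [Mem.setNat]
    rcases Nat.lt_succ_iff_lt_or_eq.1 hs' with h | rfl
    · simp [hI2.2 s' h]
    · simp [hI2.1, cntTo_n]

/-- Guarantees that a greedy choice is never a set already bought, so that the running total in real
array `3` counts every cost once. -/
theorem cnt_eq_zero_of_mem {q : ℕ} {G : Finset (Fin I.m)} {s : Fin I.m} (hs : s ∈ G) :
    I.cnt q G s = 0 := by
  classical
  unfold cnt
  rw [Finset.card_eq_zero, Finset.filter_eq_empty_iff]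
  rintro e he ⟨_, _, h⟩
  exact (Finset.mem_sdiff.1 he).2 (Finset.mem_biUnion.2 ⟨s, hs, h⟩)

theorem pick_le (q : ℕ) (G : Finset (Fin I.m)) : I.pick q G ≤ I.m := scanMin_le _

theorem sum_c_insert {G : Finset (Fin I.m)} {s : ℕ} (hs : s < I.m)
    (h : (⟨s, hs⟩ : Fin I.m) ∉ G) : ∑ t ∈ insert ⟨s, hs⟩ G, I.c t = ∑ t ∈ G, I.c t + I.cs s := by
  rw [Finset.sum_insert h, cs, dif_pos hs, add_comm]

theorem wp_choose (hw : I.Sized w R) (hD : I.n + I.m + I.T + 1 ≤ D) {q : ℕ} {M : Mem}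
    (hM : I.Base M) {G : Finset (Fin I.m)} (hc : ∀ s < I.m, M.nat 9 s 0 = I.cnt q G s)
    (hG : Marks G M) (hr : M.real 3 0 0 = ∑ s ∈ G, I.c s) :
    choose.wp w R D (fun M' => Marks (I.pickStep q G) M' ∧
      M'.real 3 0 0 = ∑ s ∈ I.pickStep q G, I.c s) M := by
  have hb : ∀ M', Agree [25, 10] [] M M' → I.Base M' := fun M' h =>
    hM.agree h (by decide) (by decide)
  refine wp_conseq (amin _ _ _) (wp_amin (fun s => 0 < I.cnt q G s)
    (fun s b => I.cs s * I.cnt q G b ≤ I.cs b * I.cnt q G s) (B := I.m) ?_ (by omega) ?_ ?_) ?_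
  · intro M' h; simp [NExp.eval, (hb M' h).m]
  · intro M' h s hs h25
    have h9 : M'.nat 9 = M.nat 9 := h.1 9 (by decide)
    refine ⟨trivial, ?_⟩
    simp [BExp.Holds, NExp.eval, h9, h25, hc s hs, Nat.one_le_iff_ne_zero, Nat.pos_iff_ne_zero]
  · intro M' h s hs b hbm h25 h10
    have h9 : M'.nat 9 = M.nat 9 := h.1 9 (by decide)
    have h1 : ∀ s, w (I.cnt q G s : ℝ) ≤ R := fun s => hw.nat _ (cnt_le q G s)
    have h2 : ∀ s t, w (I.cs s * (I.cnt q G t : ℝ)) ≤ R := fun s t => hw.cs_mul s _ (cnt_le q G t)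
    simp [BExp.Holds, BExp.Ok, RExp.Ok, RExp.eval, costX, NExp.eval, h25, h10, (hb M' h).c, h9,
      hc s hs, hc b hbm, hw.cs, h1, h2]
  · intro M1 hA1 h10
    have hA : Agree [25, 10] [] M M1 := hA1.mono (by simp [amin, modN]) (by simp [amin, modR])
    have h8 : M1.nat 8 = M.nat 8 := hA.1 8 (by decide)
    have h3 : M1.real 3 = M.real 3 := hA.2 3 (by decide)
    have hp := pick_le q G
    change M1.nat 10 0 0 = I.pick q G at h10
    refine ⟨trivial, fun h => ?_, fun h => ?_⟩
    · simp only [BExp.Holds, NExp.eval, h10] at h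
      have hlt : I.pick q G - 1 < I.m := by omega
      have hstep : I.pickStep q G = insert ⟨I.pick q G - 1, hlt⟩ G := dif_pos ⟨h, hlt⟩
      have hnot : (⟨I.pick q G - 1, hlt⟩ : Fin I.m) ∉ G := by
        intro hin
        have h1 := cnt_eq_zero_of_mem (q := q) hin
        have h2 := scanMin_mem (b := I.pick q G - 1) (show I.pick q G = _ by omega)
        simp only at h1
        omega
      simp only [wp, RExp.Ok, RExp.eval, NExp.eval, costX, Mem.setNat, Mem.setReal, h10, h3, hr,
        (hb M1 hA).c, hstep, sum_c_insert hlt hnot, Nat.reduceEqDiff, false_and, if_false]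
      refine ⟨⟨hw.sum _, hw.cs _, ?_⟩, ?_, by simp⟩
      · rw [← sum_c_insert hlt hnot]; exact hw.sum _
      · intro s
        simp only [h8, hG s, Finset.mem_insert, Fin.ext_iff]
        by_cases h1 : (s : ℕ) = I.pick q G - 1 <;> simp [h1]
    · simp only [BExp.Holds, NExp.eval, h10] at h
      have hstep : I.pickStep q G = G := dif_neg fun h' => h h'.1
      simp only [wp, hstep, h3, hr, and_true]
      intro s; rw [h8, hG s]

theorem wp_greedy (hw : I.Sized w R) (hD : I.n + I.m + I.T + 1 ≤ D) {q : ℕ} {M : Mem}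
    (hM : I.Ready q M) :
    greedy.wp w R D (fun M' => Marks (I.gr q I.n) M' ∧
      M'.real 3 0 0 = ∑ s ∈ I.gr q I.n, I.c s) M := by
  refine wp_conseq (Code.rep 21 _ _) (Q := fun M' => Marks (∅ : Finset (Fin I.m)) M')
    (wp_rep (fun i M' => ∀ s < i, M'.nat 8 s 0 = 0) (B := I.m)
      (by simp [NExp.eval, hM.base.m]) (by omega) (by simp) ?_ ?_) ?_
  · intro s hs M1 hA1 hv1 hI1 s' hs'
    simp only [Mem.setNat, NExp.eval, hv1]
    by_cases h : s' = s
    · simp [h]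
    · simp [h, hI1 s' (by omega)]
  · intro M1 _ hI1 s
    simp [hI1 s s.isLt]
  · intro M1 hA1 hG1
    have hR1 : I.Ready q M1 := hM.agree hA1 (by decide) (by decide)
    have h0 : w 0 ≤ R := by simpa using hw.sum ∅
    refine ⟨by simpa [RExp.Ok, RExp.eval, NExp.eval] using h0, ?_⟩
    set M2 := M1.setReal 3 ((NExp.const 0).eval M1) ((NExp.const 0).eval M1)
      ((RExp.ofNat (.const 0)).eval M1) with hM2
    have hR2 : I.Ready q M2 :=
      hR1.agree (agree_setReal M1 3 _ _ _ []) (by decide) (by decide)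
    refine wp_rep (fun t M' => Marks (I.gr q t) M' ∧ M'.real 3 0 0 = ∑ s ∈ I.gr q t, I.c s)
      (B := I.n) (by simp [NExp.eval, hR2.base.n]) (by omega) ?_ ?_ fun _ _ h => h
    · refine ⟨?_, ?_⟩
      · intro s
        simpa [gr, hM2, Mem.setNat, Mem.setReal] using hG1 s
      · simp [gr, hM2, Mem.setNat, Mem.setReal, NExp.eval, RExp.eval]
    · rintro t ht M3 hA3 hv3 ⟨hG3, hr3⟩
      have hR3 : I.Ready q M3 := hR2.agree hA3 (by decide) (by decide)
      refine wp_conseq covered (wp_covered hD hR3.base hG3) fun M4 hA4 hc4 => ?_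
      have hR4 : I.Ready q M4 := hR3.agree hA4 (by decide) (by decide)
      refine wp_conseq count (wp_count hw hD hR4 hc4) fun M5 hA5 hc5 => ?_
      have hR5 : I.Ready q M5 := hR4.agree hA5 (by decide) (by decide)
      have h8 : M5.nat 8 = M3.nat 8 := (hA5.1 8 (by decide)).trans (hA4.1 8 (by decide))
      have h3 : M5.real 3 = M3.real 3 := (hA5.2 3 (by decide)).trans (hA4.2 3 (by decide))
      refine wp_conseq choose (wp_choose hw hD hR5.base hc5 (fun s => by rw [h8, hG3 s])
        (by rw [h3, hr3])) fun M6 hA6 h6 => ?_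
      refine ⟨fun s => ?_, ?_⟩
      · rw [(agree_setNat M6 24 0 0 (t + 1) []).1 8 (by decide)]
        exact h6.1 s
      · simpa [Mem.setNat, gr] using h6.2

theorem wp_value (hw : I.Sized w R) (hD : I.n + I.m + I.T + 1 ≤ D) {q : ℕ} {M : Mem}
    (hM : I.Ready q M) (hd : M.nat 6 0 0 = I.dN) :
    value.wp w R D (fun M' => ∀ q', M'.real 2 q' 0 = if q' = q then I.val q else M.real 2 q' 0)
      M := by
  refine wp_conseq greedy (wp_greedy hw hD hM) fun M1 hA1 h1 => ?_
  have hR1 : I.Ready q M1 := hM.agree hA1 (by decide) (by decide)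
  have hd1 : M1.nat 6 0 0 = I.dN := by rw [hA1.1 6 (by decide), hd]
  have h21 : M1.real 2 = M.real 2 := hA1.2 2 (by decide)
  have hb : ∀ M', Agree [25, 10] [] M1 M' → I.Ready q M' := fun M' h =>
    hR1.agree h (by decide) (by decide)
  refine wp_conseq (amin _ _ _) (wp_amin (fun e => ¬ (q < I.n ∧ I.mc q ≤ I.mc e))
    (fun e b => I.mc b ≤ I.mc e) (B := I.n) ?_ (by omega) ?_ ?_) ?_
  · intro M' h; simp [NExp.eval, (hb M' h).base.n]
  · intro M' h e he h25
    refine ⟨(hb M' h).net_ok hw _, ?_⟩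
    have hx : (NExp.var 25).eval M' = e := by simp [NExp.eval, h25]
    have := (hb M' h).net_holds (.var 25) (by rw [hx]; exact he)
    rw [hx] at this
    simp only [BExp.Holds, this]
  · intro M' h e he b hbn h25 h10
    simp [BExp.Holds, BExp.Ok, RExp.Ok, RExp.eval, mcX, costX, NExp.eval, h25, h10,
      (hb M' h).base.c, (hb M' h).f _ he, (hb M' h).f _ hbn, hw.cs, mc]
  · intro M2 hA2 h10
    have hA : Agree [25, 10] [] M1 M2 := hA2.mono (by simp [amin, modN]) (by simp [amin, modR])
    have hR2 := hb M2 hA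
    have h3 : M2.real 3 = M1.real 3 := hA.2 3 (by decide)
    have h22 : M2.real 2 = M.real 2 := (hA.2 2 (by decide)).trans h21
    have hd2 : M2.nat 6 0 0 = I.dN := by rw [hA.1 6 (by decide), hd1]
    change M2.nat 10 0 0 = I.worst q at h10
    have hle : I.worst q ≤ I.n := scanMin_le _
    refine ⟨trivial, fun h => ?_, fun h => ?_⟩
    · simp only [BExp.Holds, NExp.eval, h10] at h
      have hval : I.val q = ∑ s ∈ I.gr q I.n, I.c s
          + I.lamN (I.dN - 1) * I.kN (I.dN - 1) * I.mc (I.worst q - 1) := by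
        rw [val, if_neg (by omega)]
      have h4 : w (I.kN (I.dN - 1) : ℝ) ≤ R := hw.nat _ (kN_le _)
      simp only [wp, RExp.Ok, RExp.eval, NExp.eval, lamkX, mcX, costX, Mem.setReal, h10, h3, h1.2,
        hR2.base.c, hR2.base.lam, hR2.base.k, hd2, hR2.q, hR2.f (I.worst q - 1) (by omega)]
      refine ⟨⟨hw.sum _, ⟨⟨hw.lam _, h4, hw.lam_mul _⟩, hw.cs _, hw.lam_mul_cs _ _⟩,
        hw.sum_add _ _ _⟩, fun q' => ?_⟩
      rw [hval, mc]
      by_cases hq : q' = q <;> simp [hq, h22]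
    · simp only [BExp.Holds, NExp.eval, h10] at h
      have hval : I.val q = ∑ s ∈ I.gr q I.n, I.c s := by
        rw [val, if_pos (by omega), add_zero]
      simp only [wp, RExp.Ok, RExp.eval, NExp.eval, Mem.setReal, h3, h1.2, hR2.q]
      refine ⟨hw.sum _, fun q' => ?_⟩
      rw [hval]
      by_cases hq : q' = q <;> simp [hq, h22]

theorem wp_threshold (hw : I.Sized w R) (hD : I.n + I.m + I.T + 1 ≤ D) {M : Mem}
    (hM : I.Base M) (hf : ∀ e < I.n, M.nat 5 e 0 = I.fN e) (hd : M.nat 6 0 0 = I.dN) :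
    threshold.wp w R D (fun M' => M'.nat 23 0 0 = I.best - 1) M := by
  have hval : ∀ q, w (I.val q) ≤ R := fun q => by
    unfold val; split_ifs
    · rw [add_zero]; exact hw.sum _
    · exact hw.sum_add _ _ _
  refine wp_conseq (Code.rep 23 _ _) (Q := fun M' => ∀ q < I.n + 1, M'.real 2 q 0 = I.val q)
    (wp_rep (fun i M' => ∀ q < i, M'.real 2 q 0 = I.val q) (B := I.n + 1)
      (by simp [NExp.eval, hM.n]) (by omega) (by simp) ?_ fun _ _ h => h) ?_
  · intro q hq M1 hA1 hv1 hI1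
    have hR1 : I.Ready q M1 := ⟨hM.agree hA1 (by decide) (by decide),
      fun e he => by rw [hA1.1 5 (by decide), hf e he], hv1⟩
    refine wp_conseq value (wp_value hw hD hR1 (by rw [hA1.1 6 (by decide), hd]))
      fun M2 _ h2 q' hq' => ?_
    simp only [Mem.setNat, h2 q']
    by_cases h : q' = q
    · simp [h]
    · simp [h, hI1 q' (by omega)]
  · intro M1 hA1 h1
    have hB1 : I.Base M1 := hM.agree hA1 (by decide) (by decide)
    have hb : ∀ M', Agree [25, 10] [] M1 M' → I.Base M' := fun M' h =>
      hB1.agree h (by decide) (by decide)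
    refine wp_conseq (amin _ _ _) (wp_amin (fun _ => True)
      (fun q b => I.val q ≤ I.val b) (B := I.n + 1) ?_ (by omega) ?_ ?_) ?_
    · intro M' h; simp [NExp.eval, (hb M' h).n]
    · intro M' h i _ _; simp [BExp.tt, BExp.Ok, BExp.Holds, NExp.eval]
    · intro M' h q hq b hbn h25 h10
      have h2 : M'.real 2 = M1.real 2 := h.2 2 (by decide)
      simp [BExp.Holds, BExp.Ok, RExp.Ok, RExp.eval, NExp.eval, h25, h10, h2, h1 q hq, h1 b hbn,
        hval]
    · intro M2 _ h
      change M2.nat 10 0 0 = I.best at h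
      simp [wp, Mem.setNat, NExp.eval, h]

/-- The day and the scenario are in memory. -/
structure Input (I : Problem) (i : Fin (I.T + 1)) (A : I.Seq) (M : Mem) : Prop where
  base : I.Base M
  day : M.nat 0 0 0 = I.n ∧ M.nat 0 3 0 = i
  seq : ∀ j : Fin (I.T + 1), j ≤ i → ∀ e : Fin I.n, M.nat 3 j e = 0 ↔ e ∉ A j

theorem Input.agree {i : Fin (I.T + 1)} {A : I.Seq} {M M' : Mem} {a r : List ℕ}
    (h : I.Input i A M) (hM : Agree a r M M') (ha : (0 ∉ a ∧ 1 ∉ a ∧ 2 ∉ a) ∧ 3 ∉ a)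
    (hr : 0 ∉ r ∧ 1 ∉ r) : I.Input i A M' where
  base := h.base.agree hM ha.1 hr
  day := by rw [hM.1 0 ha.1.1]; exact h.day
  seq := by rw [hM.1 3 ha.2]; exact h.seq

theorem input_input (i : Fin (I.T + 1)) (A : I.Seq) : I.Input i A (I.input i A) where
  base :=
    { n := rfl, m := rfl, T := rfl, k := fun _ => rfl
      S := fun s e => by
        split_ifs with h
        · exact if_pos h
        · exact if_neg h
      c := fun _ => rfl
      lam := fun _ => rfl }
  day := ⟨rfl, rfl⟩
  seq j hj e := by
    have := j.isLt
    simp [input, hj]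
    omega

/-- The scan searches for a revealed day whose set misses the element. It has to stop after day `i`,
since later sets read as empty. -/
theorem wp_inactive (hD : I.n + I.m + I.T + 1 ≤ D) {i : Fin (I.T + 1)} {A : I.Seq} {M : Mem}
    (hM : I.Input i A M) :
    inactive.wp w R D (fun M' => ∀ e : Fin I.n, M'.nat 14 e 0 = 0 ↔ e ∈ I.active A i) M := by
  have hb : ∀ M', Agree [20, 25, 10, 14] [] M M' → I.Input i A M' := fun M' h =>
    hM.agree h (by decide) (by decide)
  have hi := i.isLt
  refine wp_conseq _ (wp_tab (fun e j => M.nat 3 j e = 0)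
    (fun _ _ _ => True) (n := I.n) (B := i + 1)
    ?_ (by omega) ?_ (by omega) (by decide) (by decide) ?_ ?_) ?_
  · simp [NExp.eval, Mem.setNat, hM.base.n]
  · intro M' h; simp [NExp.eval, (hb M' h).day.2]
  · intro M' h e _ s hsm he hs
    refine ⟨trivial, ?_⟩
    simp [BExp.Holds, NExp.eval, hs, he, h.1 3 (by decide)]
  · intro M' _ e _ s _ b _ _ _ _
    simp [BExp.tt, BExp.Ok, BExp.Holds, NExp.eval]
  · intro M' _ h e
    rw [h e e.isLt, scanMin_eq_zero]
    simp only [active, Finset.mem_filter, Finset.mem_univ, true_and]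
    constructor
    · intro h' j hj
      have hj' : (j : ℕ) ≤ i := hj
      have := h' j (by omega)
      rw [hM.seq j hj e, not_not] at this
      exact this
    · intro h' j hj
      have hji : (⟨j, by omega⟩ : Fin (I.T + 1)) ≤ i := Fin.mk_le_of_le_val (by omega)
      have h1 := hM.seq ⟨j, by omega⟩ hji e
      simp only at h1
      rw [h1, not_not]
      exact h' _ hji

theorem wp_outGreedy (hD : I.n + I.m + I.T + 1 ≤ D) {i : Fin (I.T + 1)} {A : I.Seq} {M : Mem}
    (hM : I.Input i A M) {G : Finset (Fin I.m)} (hG : Marks G M) (hO : I.output M = ∅) :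
    outGreedy.wp w R D (fun M' => I.output M' = if i = 0 then G else ∅) M := by
  have h4 : ∀ s : Fin I.m, M.nat 4 s 0 ≠ 1 := by
    simpa [output, Finset.filter_eq_empty_iff] using hO
  refine ⟨trivial, fun h => ?_, fun h => ?_⟩
  · simp only [BExp.Holds, NExp.eval, hM.day.2, Nat.le_zero] at h
    have hi : i = 0 := Fin.ext h
    rw [if_pos hi]
    refine wp_rep (fun j M' => ∀ s : Fin I.m, M'.nat 4 s 0 = 1 ↔ s.val < j ∧ s ∈ G) (B := I.m)
      (by simp [NExp.eval, hM.base.m]) (by omega) ?_ ?_ ?_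
    · intro s; simpa [Mem.setNat] using h4 s
    · intro j hj M1 hA1 hv1 hI1
      have h8 := hG ⟨j, hj⟩
      rw [← hA1.1 8 (by decide)] at h8
      simp only at h8
      have hlt : ∀ s : Fin I.m, s.val < j + 1 ↔ s.val < j ∨ s = ⟨j, hj⟩ := fun s => by
        rw [Fin.ext_iff]; simp only; omega
      refine ⟨trivial, fun hp s => ?_, fun hp s => ?_⟩
      · simp only [BExp.Holds, NExp.eval, hv1, h8] at hp
        have hjG : (⟨j, hj⟩ : Fin I.m) ∈ G := by
          by_contra hn; simp [hn] at hp
        simp only [NExp.eval, Mem.setNat, hv1]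
        by_cases hs : s = ⟨j, hj⟩
        · subst hs; simp [hjG]
        · have : (s : ℕ) ≠ j := fun h' => hs (Fin.ext h')
          simp [this, hI1 s, hlt s, hs]
      · simp only [BExp.Holds, NExp.eval, hv1, h8] at hp
        have hjG : (⟨j, hj⟩ : Fin I.m) ∉ G := by
          intro hn; simp [hn] at hp
        simp only [Mem.setNat]
        by_cases hs : s = ⟨j, hj⟩
        · subst hs
          have h1 := hI1 ⟨j, hj⟩
          simp only [hjG, and_false, iff_false] at h1
          simp [hjG, h1]
        · simp [hI1 s, hlt s, hs]
    · intro M1 _ hI1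
      ext s; simp [output, hI1 s]
  · simp only [BExp.Holds, NExp.eval, hM.day.2, Nat.le_zero] at h
    have hi : i ≠ 0 := fun h' => h (by simp [h'])
    rw [if_neg hi]
    exact hO

theorem fN_pos (e : Fin I.n) : 0 < I.fN e := by
  rw [Nat.pos_iff_ne_zero]
  intro h
  obtain ⟨s, hs⟩ := I.covers e
  exact scanMin_eq_zero.1 h s s.isLt ⟨s.isLt, e.isLt, hs⟩

theorem fN_lt (e : Fin I.n) : I.fN e - 1 < I.m := by
  have h1 : I.fN e ≤ I.m := scanMin_le _
  have := fN_pos e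
  omega

/-- The cheapest set containing an element. -/
noncomputable def fFin (I : Problem) (e : Fin I.n) : Fin I.m := ⟨I.fN e - 1, fN_lt e⟩

theorem dN_pos : 0 < I.dN := by
  rw [Nat.pos_iff_ne_zero]
  intro h
  exact scanMin_eq_zero.1 h 0 (by omega) trivial

/-- The second day of action. -/
noncomputable def dFin (I : Problem) : Fin (I.T + 1) :=
  ⟨I.dN - 1, by have h1 : I.dN ≤ I.T + 1 := scanMin_le _; have := dN_pos (I := I); omega⟩

theorem wp_outMinSets (hD : I.n + I.m + I.T + 1 ≤ D) {i : Fin (I.T + 1)} {A : I.Seq} {M : Mem}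
    (hM : I.Input i A M) (hf : ∀ e < I.n, M.nat 5 e 0 = I.fN e) (hd : M.nat 6 0 0 = I.dN)
    {G : Finset (Fin I.m)} (hc : ∀ e : Fin I.n, M.nat 7 e 0 = 0 ↔ e ∉ I.cov G)
    (ha : ∀ e : Fin I.n, M.nat 14 e 0 = 0 ↔ e ∈ I.active A i) :
    outMinSets.wp w R D (fun M' => I.output M' = I.output M ∪
      if i = I.dFin then (I.active A i \ I.cov G).image I.fFin else ∅) M := by
  have hdp := dN_pos (I := I)
  refine ⟨⟨trivial, trivial⟩, fun h => ?_, fun h => ?_⟩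
  · simp only [BExp.Holds, NExp.eval, hM.day.2, hd] at h
    have hi : i = I.dFin := Fin.ext (by simp only [dFin]; omega)
    rw [if_pos hi]
    refine wp_rep (fun j M' => ∀ s : Fin I.m, M'.nat 4 s 0 = 1 ↔ M.nat 4 s 0 = 1 ∨
      ∃ e : Fin I.n, e.val < j ∧ e ∈ I.active A i \ I.cov G ∧ I.fFin e = s) (B := I.n)
      (by simp [NExp.eval, hM.base.n]) (by omega) ?_ ?_ ?_
    · intro s; simp [Mem.setNat]
    · intro j hj M1 hA1 hv1 hI1
      have h7 := hc ⟨j, hj⟩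
      have h14 := ha ⟨j, hj⟩
      rw [← hA1.1 7 (by decide)] at h7
      rw [← hA1.1 14 (by decide)] at h14
      have h5 := hf j hj
      rw [← hA1.1 5 (by decide)] at h5
      simp only at h7 h14
      have hiff : (BExp.and (.natLe (.at1 14 (.var 20)) (.const 0))
          (.natLe (.at1 7 (.var 20)) (.const 0))).Holds M1
          ↔ (⟨j, hj⟩ : Fin I.n) ∈ I.active A i \ I.cov G := by
        simp only [BExp.Holds, NExp.eval, hv1, Nat.le_zero, h7, h14, Finset.mem_sdiff]
      refine ⟨⟨trivial, trivial⟩, fun hp s => ?_, fun hp s => ?_⟩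
      · rw [hiff] at hp
        simp only [NExp.eval, Mem.setNat, hv1, h5]
        by_cases hs : (s : ℕ) = I.fN j - 1
        · have h1 : I.fFin ⟨j, hj⟩ = s := Fin.ext hs.symm
          rw [if_neg (by simp), if_pos (by simp [hs])]
          refine iff_of_true rfl (Or.inr ?_)
          exact ⟨⟨j, hj⟩, by simp, hp, h1⟩
        · simp only [hs, false_and, and_false, if_false]
          simp only [Nat.reduceEqDiff, false_and, if_false, hI1 s]
          refine or_congr Iff.rfl (exists_congr fun e => ⟨fun h => ⟨by omega, h.2⟩, fun h => ?_⟩)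
          refine ⟨?_, h.2⟩
          have : (e : ℕ) ≠ j := by
            rintro rfl; exact hs (by rw [← h.2.2]; rfl)
          omega
      · rw [hiff] at hp
        simp only [Mem.setNat]
        simp only [Nat.reduceEqDiff, false_and, if_false, hI1 s]
        refine or_congr Iff.rfl (exists_congr fun e => ⟨fun h => ⟨by omega, h.2⟩, fun h => ?_⟩)
        refine ⟨?_, h.2⟩
        have : (e : ℕ) ≠ j := by
          rintro rfl; exact hp h.2.1
        omega
    · intro M1 _ hI1
      ext s
      simp [output, hI1 s]
  · simp only [BExp.Holds, NExp.eval, hM.day.2, hd] at h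
    have hi : i ≠ I.dFin := by
      rintro rfl; simp only [dFin] at h; omega
    rw [if_neg hi, Finset.union_empty]
    rfl

theorem wp_main (hw : I.Sized w R) (hD : I.n + I.m + I.T + 1 ≤ D) (i : Fin (I.T + 1))
    (A : I.Seq) :
    main.wp w R D (fun M' => I.output M' =
      (I.thrifty (I.gr (I.best - 1) I.n) I.dFin I.fFin).act i A) (I.input i A) := by
  have hI0 := input_input i A
  refine wp_conseq minSets (wp_minSets hw hD hI0.base) fun M1 hA1 hf1 => ?_
  have hI1 : I.Input i A M1 := hI0.agree hA1 (by decide) (by decide)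
  refine wp_conseq minDay (wp_minDay hw hD hI1.base) fun M2 hA2 hd2 => ?_
  have hI2 : I.Input i A M2 := hI1.agree hA2 (by decide) (by decide)
  have hf2 : ∀ e < I.n, M2.nat 5 e 0 = I.fN e := by rw [hA2.1 5 (by decide)]; exact hf1
  refine wp_conseq threshold (wp_threshold hw hD hI2.base hf2 hd2) fun M3 hA3 hq3 => ?_
  have hI3 : I.Input i A M3 := hI2.agree hA3 (by decide) (by decide)
  have hf3 : ∀ e < I.n, M3.nat 5 e 0 = I.fN e := by rw [hA3.1 5 (by decide)]; exact hf2
  -- The search leaves behind the greedy collection of the last threshold tried, so greedy is run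
  -- again for the best one.
  refine wp_conseq greedy (wp_greedy hw hD ⟨hI3.base, hf3, hq3⟩) fun M4 hA4 hG4 => ?_
  have hI4 : I.Input i A M4 := hI3.agree hA4 (by decide) (by decide)
  refine wp_conseq covered (wp_covered hD hI4.base hG4.1) fun M5 hA5 hc5 => ?_
  have hI5 : I.Input i A M5 := hI4.agree hA5 (by decide) (by decide)
  refine wp_conseq inactive (wp_inactive hD hI5) fun M6 hA6 ha6 => ?_
  have hI6 : I.Input i A M6 := hI5.agree hA6 (by decide) (by decide)
  have hG6 : Marks (I.gr (I.best - 1) I.n) M6 := by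
    intro s; rw [hA6.1 8 (by decide), hA5.1 8 (by decide)]; exact hG4.1 s
  have h4 : M6.nat 4 = (I.input i A).nat 4 := by
    rw [hA6.1 4 (by decide), hA5.1 4 (by decide), hA4.1 4 (by decide), hA3.1 4 (by decide),
      hA2.1 4 (by decide), hA1.1 4 (by decide)]
  have hO : I.output M6 = ∅ := by
    simp only [output, h4, Finset.filter_eq_empty_iff]
    intro s _; simp [input]
  refine wp_conseq outGreedy (wp_outGreedy hD hI6 hG6 hO) fun M7 hA7 ho7 => ?_
  have hI7 : I.Input i A M7 := hI6.agree hA7 (by decide) (by decide)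
  refine wp_conseq outMinSets (wp_outMinSets hD hI7 ?_ ?_ (G := I.gr (I.best - 1) I.n) ?_ ?_)
    fun M8 _ h8 => ?_
  · rw [hA7.1 5 (by decide), hA6.1 5 (by decide), hA5.1 5 (by decide), hA4.1 5 (by decide)]
    exact hf3
  · rw [hA7.1 6 (by decide), hA6.1 6 (by decide), hA5.1 6 (by decide), hA4.1 6 (by decide),
      hA3.1 6 (by decide)]
    exact hd2
  · rw [hA7.1 7 (by decide), hA6.1 7 (by decide)]; exact hc5
  · rw [hA7.1 14 (by decide)]; exact ha6
  · rw [h8, ho7]; rfl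

end Problem


namespace Problem

open Code

variable {I : Problem}

/-! ### The algorithm computes a thrifty strategy -/

theorem cs_val (s : Fin I.m) : I.cs s = I.c s := by simp [cs]

theorem mc_val (e : Fin I.n) : I.mc e = I.c (I.fFin e) := by
  rw [← cs_val]; rfl

theorem isMinSet_fFin (e : Fin I.n) : I.IsMinSet e (I.fFin e) := by
  have h : I.fN e = (I.fN e - 1) + 1 := by have := fN_pos e; omega
  refine ⟨?_, fun s' hs' => ?_⟩
  · obtain ⟨_, _, h3⟩ := scanMin_mem h
    exact h3
  · rw [← mc_val, ← cs_val]
    exact scanMin_min (key := I.cs) (fun _ _ _ _ => Iff.rfl) h s' s'.isLt ⟨s'.isLt, e.isLt, hs'⟩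

theorem lamN_val (j : Fin (I.T + 1)) : I.lamN j = I.lam j := dif_pos j.isLt

theorem kN_val (j : Fin (I.T + 1)) : I.kN j = I.k j := dif_pos j.isLt

theorem dFin_min (j : Fin (I.T + 1)) :
    I.lam I.dFin * I.k I.dFin ≤ I.lam j * I.k j := by
  have h : I.dN = (I.dN - 1) + 1 := by have := dN_pos (I := I); omega
  have := scanMin_min (key := fun j => I.lamN j * I.kN j) (fun _ _ _ _ => Iff.rfl) h j
    j.isLt trivial
  rw [← lamN_val, ← lamN_val, ← kN_val, ← kN_val]
  exact this

theorem cnt_val (q : ℕ) (G : Finset (Fin I.m)) (s : Fin I.m) :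
    I.cnt q G s = (I.S s ∩ (I.netQ q \ I.cov G)).card := by
  unfold cnt
  congr 1
  ext e
  simp only [Finset.mem_filter, Finset.mem_inter, inS, s.isLt, e.isLt, exists_true_left, Fin.eta]
  exact and_comm

theorem greedyReach_gr (q t : ℕ) : I.GreedyReach (I.netQ q) (I.gr q t) := by
  induction t with
  | zero => exact GreedyReach.empty
  | succ t ih =>
    simp only [gr, pickStep]
    split_ifs with h
    · have hp : I.pick q (I.gr q t) = (I.pick q (I.gr q t) - 1) + 1 := by omega
      have h1 := scanMin_mem hp
      have h2 := scanMin_min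
        (key := fun s => I.cs s / (I.cnt q (I.gr q t) s : ℝ)) (fun i b hi hb => by
          rw [div_le_div_iff₀ (by exact_mod_cast hi) (by exact_mod_cast hb)]) hp
      refine GreedyReach.step _ _ ih ?_ fun s' hs' => ?_
      · rw [← Finset.card_pos, ← cnt_val]; exact h1
      · rw [← Finset.card_pos, ← cnt_val] at hs'
        have := h2 s' s'.isLt hs'
        rw [← cnt_val, ← cnt_val, ← cs_val, ← cs_val]
        exact this
    · exact ih

/-- While a net element is uncovered, some set of the family contains it, so a candidate exists and
the choice covers something new. Hence `n` rounds suffice. -/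
theorem card_sdiff_gr (q t : ℕ) : (I.netQ q \ I.cov (I.gr q t)).card ≤ I.n - t := by
  induction t with
  | zero => exact (Finset.card_le_univ _).trans (by simp)
  | succ t ih =>
    simp only [gr, pickStep]
    split_ifs with h
    · have hp : I.pick q (I.gr q t) = (I.pick q (I.gr q t) - 1) + 1 := by omega
      have h1 := scanMin_mem hp
      set s : Fin I.m := ⟨I.pick q (I.gr q t) - 1, h.2⟩ with hs
      have h2 : 0 < (I.S s ∩ (I.netQ q \ I.cov (I.gr q t))).card := by rw [← cnt_val]; exact h1
      obtain ⟨e, he⟩ := Finset.card_pos.1 h2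
      rw [Finset.mem_inter] at he
      have h3 : (I.netQ q \ I.cov (insert s (I.gr q t))).card
          < (I.netQ q \ I.cov (I.gr q t)).card := by
        apply Finset.card_lt_card
        refine Finset.ssubset_iff_of_subset (fun x hx => ?_) |>.2 ⟨e, he.2, fun hx => ?_⟩
        · simp only [cov_insert, Finset.mem_sdiff, Finset.mem_union, not_or] at hx ⊢
          exact ⟨hx.1, hx.2.2⟩
        · simp only [cov_insert, Finset.mem_sdiff, Finset.mem_union, not_or] at hx
          exact hx.2.1 he.1
      omega
    · have hp : I.pick q (I.gr q t) = 0 := by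
        have := pick_le q (I.gr q t)
        by_contra hne
        exact h ⟨by omega, by omega⟩
      have : I.netQ q \ I.cov (I.gr q t) = ∅ := by
        rw [Finset.eq_empty_iff_forall_notMem]
        intro e he
        obtain ⟨s, hs⟩ := I.covers e
        refine scanMin_eq_zero.1 hp s s.isLt ?_
        rw [cnt_val]
        exact Finset.card_pos.2 ⟨e, Finset.mem_inter.2 ⟨hs, he⟩⟩
      rw [this]; simp

theorem netQ_subset_cov (q : ℕ) : I.netQ q ⊆ I.cov (I.gr q I.n) := by
  have h := card_sdiff_gr (I := I) q I.n
  rw [Nat.sub_self, Nat.le_zero, Finset.card_eq_zero, Finset.sdiff_eq_empty_iff_subset] at h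
  exact h

theorem mem_net_iff (τ : ℝ) (e : Fin I.n) : e ∈ I.net τ ↔ τ ≤ I.mc e := by
  have h := isMinSet_fFin e
  simp only [net, Finset.mem_filter, Finset.mem_univ, true_and]
  rw [mc_val]
  exact ⟨fun h' => h' _ h.1, fun h' s hs => h'.trans (h.2 s hs)⟩

theorem mem_netQ_iff (q : ℕ) (e : Fin I.n) : e ∈ I.netQ q ↔ q < I.n ∧ I.mc q ≤ I.mc e := by
  simp [netQ]

theorem exists_net_eq_netQ (q : ℕ) : ∃ τ, I.net τ = I.netQ q := by
  by_cases hq : q < I.n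
  · refine ⟨I.mc q, ?_⟩
    ext e
    rw [mem_net_iff, mem_netQ_iff, and_iff_right hq]
  -- Here the net is empty; this threshold exceeds every `mc e`.
  · refine ⟨∑ e : Fin I.n, |I.mc e| + 1, ?_⟩
    ext e
    rw [mem_net_iff, mem_netQ_iff]
    refine iff_of_false (fun h => ?_) fun h => hq h.1
    have h1 := Finset.single_le_sum (f := fun e : Fin I.n => |I.mc e|) (fun _ _ => abs_nonneg _)
      (Finset.mem_univ e)
    have h2 := le_abs_self (I.mc e)
    linarith

/-- Raising the threshold to the smallest `mc e` within a nonempty net does not change the net. Thus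
the `n + 1` indices represent all thresholds, including the one in the analysis that depends on
`Opt`. -/
theorem exists_netQ_eq_net (τ : ℝ) : ∃ q ≤ I.n, I.netQ q = I.net τ := by
  rcases (I.net τ).eq_empty_or_nonempty with h | h
  · refine ⟨I.n, le_rfl, ?_⟩
    rw [h, Finset.eq_empty_iff_forall_notMem]
    intro e he
    exact lt_irrefl _ ((mem_netQ_iff _ _).1 he).1
  · obtain ⟨q, hq, hmin⟩ := Finset.exists_min_image (I.net τ) (fun e => I.mc e) h
    refine ⟨q, q.isLt.le, ?_⟩
    ext e
    rw [mem_netQ_iff, and_iff_right q.isLt]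
    refine ⟨fun h' => ?_, fun h' => hmin e h'⟩
    rw [mem_net_iff] at hq ⊢
    exact hq.trans h'

theorem lam_nonneg (j : Fin (I.T + 1)) : 0 ≤ I.lam j := zero_le_one.trans (I.one_le_lam j)

theorem val_best_le {q : ℕ} (hq : q ≤ I.n) : I.val (I.best - 1) ≤ I.val q := by
  have hpos : I.best ≠ 0 := fun h => scanMin_eq_zero.1 h 0 (by omega) trivial
  have h : I.best = (I.best - 1) + 1 := by omega
  exact scanMin_min (key := I.val) (fun _ _ _ _ => Iff.rfl) h q (by omega) trivial

theorem val_eq (q : ℕ) : I.val q = ∑ s ∈ I.gr q I.n, I.c s +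
    if I.worst q = 0 then 0 else I.lam I.dFin * I.k I.dFin * I.mc (I.worst q - 1) := by
  rw [val, ← lamN_val, ← kN_val]; rfl

theorem worst_spec {q : ℕ} (e : Fin I.n) (he : e ∉ I.netQ q) :
    I.worst q ≠ 0 ∧ I.mc e ≤ I.mc (I.worst q - 1) := by
  rw [mem_netQ_iff] at he
  have h0 : I.worst q ≠ 0 := fun h => scanMin_eq_zero.1 h e e.isLt he
  refine ⟨h0, ?_⟩
  have h : I.worst q = (I.worst q - 1) + 1 := by omega
  have := scanMin_min (key := fun e => - I.mc e) (fun _ _ _ _ => neg_le_neg_iff.symm) h e e.isLt he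
  exact neg_le_neg_iff.1 this

theorem worst_mem {q : ℕ} (h : I.worst q ≠ 0) :
    ∃ e : Fin I.n, e ∉ I.netQ q ∧ (e : ℕ) = I.worst q - 1 := by
  have hle : I.worst q ≤ I.n := scanMin_le _
  refine ⟨⟨I.worst q - 1, by omega⟩, ?_, rfl⟩
  rw [mem_netQ_iff]
  exact scanMin_mem (show I.worst q = (I.worst q - 1) + 1 by omega)

theorem mc_nonneg (e : Fin I.n) : 0 ≤ I.mc e := by rw [mc_val]; exact I.c_nonneg _

theorem thrifty_feasible (G : Finset (Fin I.m)) (d : Fin (I.T + 1)) (f : Fin I.n → Fin I.m)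
    (hf : ∀ e, e ∈ I.S (f e)) : (I.thrifty G d f).Feasible := by
  intro A _ e he
  simp only [cov, Finset.mem_biUnion, Finset.mem_univ, true_and]
  by_cases hG : e ∈ I.cov G
  · simp only [cov, Finset.mem_biUnion] at hG
    obtain ⟨s, hs, hes⟩ := hG
    exact ⟨s, ⟨0, by simp [thrifty, hs]⟩, hes⟩
  · refine ⟨f e, ⟨d, ?_⟩, hf e⟩
    simp only [thrifty, if_true, Finset.mem_union]
    refine Or.inr (Finset.mem_image_of_mem f (Finset.mem_sdiff.2 ⟨?_, hG⟩))
    simp only [active, Finset.mem_filter, Finset.mem_univ, true_and] at he ⊢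
    exact fun j _ => he j (Fin.le_last j)

theorem sum_image_c_le (X : Finset (Fin I.n)) (f : Fin I.n → Fin I.m) :
    ∑ s ∈ X.image f, I.c s ≤ ∑ e ∈ X, I.c (f e) := by
  have := sum_biUnion_le_sum (q := I.c) I.c_nonneg X (fun e => ({f e} : Finset (Fin I.m)))
  rw [Finset.biUnion_singleton] at this
  simpa using this

/-- Greedy covers the net, so each element served on the second day lies outside it and costs at
most the worst such element; at most `k` elements are active that day. -/
theorem robCov_le_val (q : ℕ) : (I.thrifty (I.gr q I.n) I.dFin I.fFin).robCov ≤ I.val q := by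
  set G := I.gr q I.n with hG
  have hG0 : 0 ≤ ∑ s ∈ G, I.c s := Finset.sum_nonneg fun s _ => I.c_nonneg s
  have hld := lam_nonneg I.dFin
  have hval0 : 0 ≤ I.val q := by
    rw [val_eq]
    refine add_nonneg hG0 ?_
    split_ifs with h
    · exact le_rfl
    · obtain ⟨e, -, he⟩ := worst_mem h
      rw [← he]
      have := mc_nonneg e
      positivity
  refine Real.iSup_le (fun A => ?_) hval0
  obtain ⟨A, hA⟩ := A
  set X := I.active A I.dFin \ I.cov G with hX
  have hcost : (I.thrifty G I.dFin I.fFin).cost A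
      ≤ ∑ s ∈ G, I.c s + I.lam I.dFin * ∑ s ∈ X.image I.fFin, I.c s := by
    -- Bounding by a sum of two terms also covers the case that both collections are bought on day
    -- `0`.
    have h1 : ∀ i, I.lam i * ∑ s ∈ (I.thrifty G I.dFin I.fFin).act i A, I.c s
        ≤ (if i = 0 then ∑ s ∈ G, I.c s else 0)
          + (if i = I.dFin then I.lam I.dFin * ∑ s ∈ X.image I.fFin, I.c s else 0) := by
      intro i
      have h2 : ∑ s ∈ (I.thrifty G I.dFin I.fFin).act i A, I.c s
          ≤ ∑ s ∈ (if i = 0 then G else ∅), I.c s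
            + ∑ s ∈ (if i = I.dFin then X.image I.fFin else ∅), I.c s := by
        have h3 : (I.thrifty G I.dFin I.fFin).act i A
            = (if i = 0 then G else ∅) ∪ (if i = I.dFin then X.image I.fFin else ∅) := by
          by_cases hi : i = I.dFin
          · subst hi; rfl
          · simp [thrifty, hi]
        rw [h3, ← Finset.sum_union_inter]
        exact le_add_of_nonneg_right (Finset.sum_nonneg fun s _ => I.c_nonneg s)
      refine (mul_le_mul_of_nonneg_left h2 (lam_nonneg i)).trans_eq ?_
      rw [mul_add]
      congr 1
      · split_ifs with h
        · rw [h, I.lam_zero, one_mul]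
        · simp
      · split_ifs with h
        · rw [h]
        · simp
    refine (Finset.sum_le_sum fun i _ => h1 i).trans_eq ?_
    rw [Finset.sum_add_distrib]
    simp
  refine hcost.trans ?_
  rw [val_eq]
  refine add_le_add le_rfl ?_
  have hXc : X.card ≤ I.k I.dFin := by
    rw [← hA I.dFin]
    refine Finset.card_le_card fun e he => ?_
    have := (Finset.mem_sdiff.1 he).1
    simp only [active, Finset.mem_filter, Finset.mem_univ, true_and] at this
    exact this _ le_rfl
  have hXn : ∀ e ∈ X, e ∉ I.netQ q := fun e he h =>
    (Finset.mem_sdiff.1 he).2 (netQ_subset_cov q h)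
  rcases X.eq_empty_or_nonempty with hXe | ⟨e0, he0⟩
  · rw [hXe]
    simp only [Finset.image_empty, Finset.sum_empty, mul_zero]
    split_ifs with h
    · exact le_rfl
    · obtain ⟨e, -, he⟩ := worst_mem h
      rw [← he]
      have := mc_nonneg e
      positivity
  · rw [if_neg (worst_spec e0 (hXn e0 he0)).1, mul_assoc]
    refine mul_le_mul_of_nonneg_left ?_ hld
    have hw0 : 0 ≤ I.mc (I.worst q - 1) :=
      (mc_nonneg e0).trans (worst_spec e0 (hXn e0 he0)).2
    calc ∑ s ∈ X.image I.fFin, I.c s ≤ ∑ e ∈ X, I.c (I.fFin e) := sum_image_c_le X _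
      _ ≤ X.card • I.mc (I.worst q - 1) := Finset.sum_le_card_nsmul _ _ _ fun e he => by
          rw [← mc_val]; exact (worst_spec e (hXn e he)).2
      _ ≤ I.k I.dFin * I.mc (I.worst q - 1) := by
          rw [nsmul_eq_mul]; gcongr

/-! ### The approximation guarantee -/

theorem Strategy.cost_nonneg (Φ : I.Strategy) (A : I.Seq) : 0 ≤ Φ.cost A :=
  Finset.sum_nonneg fun i _ => mul_nonneg (lam_nonneg i)
    (Finset.sum_nonneg fun s _ => I.c_nonneg s)

theorem Strategy.robCov_nonneg (Φ : I.Strategy) : 0 ≤ Φ.robCov :=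
  Real.iSup_nonneg fun A => Φ.cost_nonneg A.1

theorem opt_nonneg : 0 ≤ I.opt := Real.iInf_nonneg fun Φ => Φ.1.robCov_nonneg

instance : Nonempty {Φ : I.Strategy // Φ.Feasible} :=
  ⟨⟨I.thrifty ∅ 0 I.fFin, thrifty_feasible _ _ _ fun e => (isMinSet_fFin e).1⟩⟩

theorem exists_feasible_lt {B : ℝ} (hB : I.opt < B) :
    ∃ Φ : I.Strategy, Φ.Feasible ∧ Φ.robCov < B := by
  obtain ⟨Φ, hΦ⟩ := exists_lt_of_ciInf_lt hB
  exact ⟨Φ.1, Φ.2, hΦ⟩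

theorem val_le_of_net {q : ℕ} {τ : ℝ} (hq : I.netQ q = I.net τ) (hτ : 0 ≤ τ) :
    I.val q ≤ ∑ s ∈ I.gr q I.n, I.c s + I.lam I.dFin * I.k I.dFin * τ := by
  have hld := lam_nonneg I.dFin
  rw [val_eq]
  refine add_le_add le_rfl ?_
  split_ifs with h
  · positivity
  · obtain ⟨e, hen, he⟩ := worst_mem h
    rw [← he]
    rw [hq, mem_net_iff, not_le] at hen
    exact mul_le_mul_of_nonneg_left hen.le (by positivity)

/-- Index `n` encodes the empty net, on which only the zero packing lives. This candidate, which
postpones everything to the second day, settles the degenerate cases. -/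
theorem cost_gr_n : ∑ s ∈ I.gr I.n I.n, I.c s ≤ 0 := by
  have := GreedyReach.cost_le I (greedyReach_gr (I := I) I.n I.n) (K := 0) fun y _ yN _ => by
    refine (Finset.sum_eq_zero fun e _ => yN e fun he => ?_).le
    exact lt_irrefl _ ((mem_netQ_iff _ _).1 he).1
  simpa using this

theorem val_n_le : I.val I.n ≤
    if I.worst I.n = 0 then 0 else I.lam I.dFin * I.k I.dFin * I.mc (I.worst I.n - 1) := by
  rw [val_eq]
  have := cost_gr_n (I := I)
  linarith

/-- Needed when `n = m = 1`: then both logarithms vanish and the guarantee demands exact optimality.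
The single element is never removed, so some set containing it is bought, at a factor of at least
`1`. -/
theorem mc_le_robCov_of_n_eq_one (hn : I.n = 1) (hk : ∀ j, 0 < I.k j) {Φ : I.Strategy}
    (hΦ : Φ.Feasible) (e : Fin I.n) : I.mc e ≤ Φ.robCov := by
  have hA : I.IsScenario fun _ => Finset.univ := fun j => by
    have := I.k_le j
    have := hk j
    simp only [Finset.card_univ, Fintype.card_fin]; omega
  refine le_trans ?_ (Φ.cost_le_robCov hA)
  have hcov := hΦ _ hA (show e ∈ _ by simp [active])
  simp only [cov, Finset.mem_biUnion, Finset.mem_univ, true_and] at hcov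
  obtain ⟨s, ⟨j, hj⟩, hs⟩ := hcov
  have h1 : I.c s ≤ ∑ s ∈ Φ.act j fun _ => Finset.univ, I.c s :=
    Finset.single_le_sum (fun s _ => I.c_nonneg s) hj
  have h2 : I.lam j * ∑ s ∈ Φ.act j fun _ => Finset.univ, I.c s ≤ Φ.cost fun _ => Finset.univ :=
    Finset.single_le_sum
      (f := fun j => I.lam j * ∑ s ∈ Φ.act j fun _ => Finset.univ, I.c s)
      (fun i _ => mul_nonneg (lam_nonneg i) (Finset.sum_nonneg fun s _ => I.c_nonneg s))
      (Finset.mem_univ j)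
  have h3 := I.one_le_lam j
  have h4 := I.c_nonneg s
  rw [mc_val]
  have h5 := (isMinSet_fFin e).2 s hs
  nlinarith

/-- The first summand is the greedy cost by `packing_le` and dual fitting, the second is `W τ`.
Working with `B > Opt` keeps `B` positive even when the optimum is `0`. -/
theorem val_best_le_of_lt {B : ℝ} (hB : I.opt < B) (hk : ∀ j, 0 < I.k j) :
    I.val (I.best - 1)
      ≤ (4 * (harmonic I.n : ℝ) + 4 * (Real.log I.m + Real.log I.n + 3)) * B := by
  have B0 : 0 < B := opt_nonneg.trans_lt hB
  obtain ⟨Φ, hΦ, hΦB⟩ := exists_feasible_lt hB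
  set W := I.lam I.dFin * I.k I.dFin with hW
  have W0 : 0 < W := by
    have h1 := I.one_le_lam I.dFin
    have h2 : (0 : ℝ) < I.k I.dFin := by exact_mod_cast hk _
    positivity
  have hm := Real.log_natCast_nonneg I.m
  have hn := Real.log_natCast_nonneg I.n
  set τ := 4 * (Real.log I.m + Real.log I.n + 3) * B / W with hτ
  have hWτ : W * τ = 4 * (Real.log I.m + Real.log I.n + 3) * B := by
    rw [hτ]; field_simp
  obtain ⟨q, hqn, hq⟩ := exists_netQ_eq_net (I := I) τ
  refine (val_best_le hqn).trans ((val_le_of_net hq (by positivity)).trans ?_)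
  rw [← hW, hWτ]
  have hg := GreedyReach.cost_le I (greedyReach_gr (I := I) q I.n) (K := 4 * B)
    fun y y0 yN ypack => I.packing_le hΦ B0
      (fun A hA => (Φ.cost_le_robCov hA).trans hΦB.le) hk W0 dFin_min hWτ y y0
      (fun e he => yN e (by rw [hq]; exact he)) ypack
  linarith

/-- If some `k j` is `0`, then `min λ_j k_j = 0` and postponing everything is free. If `n = m = 1`,
postponing is optimal. Otherwise `log m + log n ≥ log 2`, which absorbs the additive constants. -/
theorem val_best_le_opt :
    I.val (I.best - 1) ≤ max 1 (32 * (Real.log I.m + Real.log I.n)) * I.opt := by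
  have opt0 := opt_nonneg (I := I)
  have hm := Real.log_natCast_nonneg I.m
  have hn := Real.log_natCast_nonneg I.n
  by_cases hk : ∀ j, 0 < I.k j
  · by_cases hsmall : I.n ≤ 1 ∧ I.m ≤ 1
    · have hn1 : I.n = 1 := by
        have := hk 0; rw [I.k_zero] at this; omega
      have h1 : I.val (I.best - 1) ≤ I.opt := by
        refine le_ciInf fun Φ => ?_
        refine (val_best_le le_rfl).trans (val_n_le.trans ?_)
        split_ifs with h
        · exact Φ.1.robCov_nonneg
        · obtain ⟨e, -, he⟩ := worst_mem h
          rw [← he]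
          refine le_trans ?_ (mc_le_robCov_of_n_eq_one hn1 hk Φ.2 e)
          have h1 := dFin_min (I := I) 0
          rw [I.lam_zero, I.k_zero, hn1] at h1
          have h2 := mc_nonneg e
          calc _ ≤ 1 * I.mc e := mul_le_mul_of_nonneg_right (by simpa using h1) h2
            _ = _ := one_mul _
      refine h1.trans ?_
      exact le_mul_of_one_le_left opt0 (le_max_left _ _)
    · have hL : 2 / 3 ≤ Real.log I.m + Real.log I.n := by
        have h2 : (2 : ℝ) / 3 ≤ Real.log 2 := by
          have := Real.log_two_gt_d9; linarith
        rcases not_and_or.1 hsmall with h | h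
        · have : Real.log 2 ≤ Real.log I.n :=
            Real.log_le_log (by norm_num) (by exact_mod_cast not_le.1 h)
          linarith
        · have : Real.log 2 ≤ Real.log I.m :=
            Real.log_le_log (by norm_num) (by exact_mod_cast not_le.1 h)
          linarith
      set L := Real.log I.m + Real.log I.n with hLdef
      -- With `H n ≤ 1 + L` the left side is at most `8 L + 16`, and `16 ≤ 24 L` because `L ≥ 2/3`.
      have hγ : 4 * (harmonic I.n : ℝ) + 4 * (L + 3) ≤ 32 * L := by
        have := harmonic_le_one_add_log I.n
        linarith
      have hγ0 : 0 < 32 * L := by linarith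
      have h1 : I.val (I.best - 1) / (32 * L) ≤ I.opt := by
        refine le_of_forall_gt_imp_ge_of_dense fun B hB => ?_
        rw [div_le_iff₀ hγ0, mul_comm]
        exact (val_best_le_of_lt hB hk).trans
          (mul_le_mul_of_nonneg_right hγ (opt0.trans hB.le))
      rw [div_le_iff₀ hγ0, mul_comm] at h1
      exact h1.trans (mul_le_mul_of_nonneg_right (le_max_right _ _) opt0)
  · push Not at hk
    obtain ⟨j, hj⟩ := hk
    have hj0 : I.k j = 0 := Nat.le_zero.1 hj
    have hW : I.lam I.dFin * I.k I.dFin = 0 := by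
      refine le_antisymm ?_ (mul_nonneg (lam_nonneg _) (Nat.cast_nonneg _))
      have := dFin_min (I := I) j
      rw [hj0] at this
      simpa using this
    have h1 := (val_best_le (I := I) le_rfl).trans val_n_le
    rw [hW, zero_mul, ite_self] at h1
    refine h1.trans (mul_nonneg ?_ opt0)
    exact zero_le_one.trans (le_max_left _ _)

end Problem

/-! ### Bit lengths of rational numbers -/

/-- `x` is a fraction of integers with at most `e` bits. -/
def HasWeight (x : ℝ) (e : ℕ) : Prop :=
  ∃ (p : ℤ) (q : ℕ), 0 < q ∧ p.natAbs < 2 ^ e ∧ q < 2 ^ e ∧ x = p / q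

theorem HasWeight.mono {x : ℝ} {e e' : ℕ} (h : HasWeight x e) (he : e ≤ e') : HasWeight x e' := by
  obtain ⟨p, q, h1, h2, h3, h4⟩ := h
  have := Nat.pow_le_pow_right (n := 2) (by norm_num) he
  exact ⟨p, q, h1, by omega, by omega, h4⟩

theorem HasWeight.mul {x y : ℝ} {e f : ℕ} (hx : HasWeight x e) (hy : HasWeight y f) :
    HasWeight (x * y) (e + f) := by
  obtain ⟨p, q, h1, h2, h3, rfl⟩ := hx
  obtain ⟨p', q', h1', h2', h3', rfl⟩ := hy
  refine ⟨p * p', q * q', Nat.mul_pos h1 h1', ?_, ?_, ?_⟩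
  · rw [Int.natAbs_mul, pow_add]
    exact Nat.mul_lt_mul'' h2 h2'
  · rw [pow_add]
    exact Nat.mul_lt_mul'' h3 h3'
  · push_cast
    rw [div_mul_div_comm]

theorem HasWeight.add {x y : ℝ} {e f : ℕ} (hx : HasWeight x e) (hy : HasWeight y f) :
    HasWeight (x + y) (e + f + 1) := by
  obtain ⟨p, q, h1, h2, h3, rfl⟩ := hx
  obtain ⟨p', q', h1', h2', h3', rfl⟩ := hy
  refine ⟨p * q' + q * p', q * q', Nat.mul_pos h1 h1', ?_, ?_, ?_⟩
  · have a1 : (p * q').natAbs < 2 ^ e * 2 ^ f := by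
      rw [Int.natAbs_mul, Int.natAbs_natCast]; exact Nat.mul_lt_mul'' h2 h3'
    have a2 : (q * p').natAbs < 2 ^ e * 2 ^ f := by
      rw [Int.natAbs_mul, Int.natAbs_natCast]; exact Nat.mul_lt_mul'' h3 h2'
    have a3 := Int.natAbs_add_le (p * q') (q * p')
    rw [pow_succ, pow_add]; omega
  · have : q * q' < 2 ^ e * 2 ^ f := Nat.mul_lt_mul'' h3 h3'
    rw [pow_succ, pow_add]; omega
  · have hq : (q : ℝ) ≠ 0 := by exact_mod_cast h1.ne'
    have hq' : (q' : ℝ) ≠ 0 := by exact_mod_cast h1'.ne'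
    push_cast
    rw [div_add_div _ _ hq hq']

theorem hasWeight_natCast (a : ℕ) : HasWeight a (a + 1) := by
  have : a + 1 < 2 ^ (a + 1) := Nat.lt_two_pow_self
  exact ⟨a, 1, one_pos, by rw [Int.natAbs_natCast]; omega, by omega, by simp⟩

theorem hasWeight_zero : HasWeight 0 1 := by simpa using hasWeight_natCast 0

theorem HasWeight.sum {ι : Type*} (G : Finset ι) {x : ι → ℝ} {e : ι → ℕ}
    (h : ∀ i, HasWeight (x i) (e i)) : HasWeight (∑ i ∈ G, x i) (∑ i ∈ G, (e i + 1) + 1) := by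
  classical
  induction G using Finset.induction_on with
  | empty => simpa using hasWeight_zero
  | insert i G hi ih =>
    rw [Finset.sum_insert hi, Finset.sum_insert hi]
    exact ((h i).add ih).mono (by omega)

theorem hasWeight_bitSize {x : ℝ} (h : ∃ q : ℚ, (q : ℝ) = x) : HasWeight x (bitSize x) := by
  have hc := h.choose_spec
  rw [bitSize, dif_pos h]
  set r := h.choose
  refine ⟨r.num, r.den, r.den_pos, ?_, ?_, ?_⟩
  · exact (Nat.lt_size_self _).trans_le (Nat.pow_le_pow_right (by norm_num) (Nat.le_add_right _ _))
  · exact (Nat.lt_size_self _).trans_le (Nat.pow_le_pow_right (by norm_num) (Nat.le_add_left _ _))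
  · rw [← hc]; exact Rat.cast_def r

/-- `HasWeight` allows unreduced fractions, for which sums and products have additive weights;
passing to lowest terms only shrinks numerator and denominator. -/
theorem HasWeight.bitSize_le {x : ℝ} {e : ℕ} (h : HasWeight x e) : bitSize x ≤ 2 * e := by
  obtain ⟨p, q, h1, h2, h3, hx⟩ := h
  unfold bitSize
  split_ifs with h
  · have hc := h.choose_spec
    set r := h.choose
    have hr : r = Rat.divInt p q := by
      have : (r : ℝ) = ((Rat.divInt p q : ℚ) : ℝ) := by
        rw [hc, hx, Rat.divInt_eq_div]; push_cast; rfl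
      exact_mod_cast this
    have hnum : r.num.natAbs ≤ p.natAbs := by
      by_cases hp : p = 0
      · simp [hr, hp]
      · have hd : r.num ∣ p := by rw [hr]; exact Rat.num_dvd p (by omega)
        exact Nat.le_of_dvd (Int.natAbs_pos.2 hp) (Int.natAbs_dvd_natAbs.2 hd)
    have hden : r.den ≤ q := by
      have hd : (r.den : ℤ) ∣ q := by rw [hr]; exact Rat.den_dvd p q
      exact Nat.le_of_dvd h1 (by exact_mod_cast hd)
    have a1 : Nat.size r.num.natAbs ≤ e := Nat.size_le.2 (hnum.trans_lt h2)
    have a2 : Nat.size r.den ≤ e := Nat.size_le.2 (hden.trans_lt h3)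
    omega
  · exact Nat.zero_le _

/-! ### Sizes of the computed numbers and the running time -/

namespace Problem

open Code

variable {I : Problem}

/-- The heaviest number is a sum of costs plus a product of three factors: its weight is `(L + 1) +
3 (L + 1) + 1 = 4 L + 5`, and numerator and denominator together double it. -/
theorem sized_bitSize (h : I.IsRational) : I.Sized bitSize (8 * I.bitLength + 10) := by
  set L := I.bitLength with hL
  have hL' : I.n + I.m + I.T + ∑ s, bitSize (I.c s) + ∑ j, bitSize (I.lam j) = L := rfl
  have hc : ∀ s, HasWeight (I.cs s) (L + 1) := by
    intro s
    unfold cs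
    split_ifs with hs
    · refine (hasWeight_bitSize (h.1 _)).mono ?_
      have := Finset.single_le_sum (f := fun s => bitSize (I.c s)) (fun _ _ => Nat.zero_le _)
        (Finset.mem_univ (⟨s, hs⟩ : Fin I.m))
      omega
    · exact hasWeight_zero.mono (by omega)
  have hl : ∀ j, HasWeight (I.lamN j) (L + 1) := by
    intro j
    unfold lamN
    split_ifs with hj
    · refine (hasWeight_bitSize (h.2 _)).mono ?_
      have := Finset.single_le_sum (f := fun j => bitSize (I.lam j)) (fun _ _ => Nat.zero_le _)
        (Finset.mem_univ (⟨j, hj⟩ : Fin (I.T + 1)))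
      omega
    · exact hasWeight_zero.mono (by omega)
  have hn : ∀ a ≤ I.n, HasWeight (a : ℝ) (L + 1) := fun a ha =>
    (hasWeight_natCast a).mono (by omega)
  -- Weights add up over the summands, and the extra bit for each addition is paid by the term `m`
  -- in `L`.
  have hs : ∀ G : Finset (Fin I.m), HasWeight (∑ s ∈ G, I.c s) (L + 1) := by
    intro G
    refine (HasWeight.sum G (x := I.c) fun s => hasWeight_bitSize (h.1 s)).mono ?_
    have h1 : ∑ s ∈ G, (bitSize (I.c s) + 1) ≤ ∑ s, (bitSize (I.c s) + 1) :=
      Finset.sum_le_univ_sum_of_nonneg fun _ => Nat.zero_le _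
    rw [Finset.sum_add_distrib (s := Finset.univ)] at h1
    simp only [Finset.sum_const, Finset.card_univ, Fintype.card_fin, smul_eq_mul, mul_one] at h1
    omega
  have hlk : ∀ j, HasWeight (I.lamN j * I.kN j) (L + 1 + (L + 1)) := fun j =>
    (hl j).mul (hn _ (kN_le j))
  have hlc : ∀ j s, HasWeight (I.lamN j * I.kN j * I.cs s) (L + 1 + (L + 1) + (L + 1)) :=
    fun j s => (hlk j).mul (hc s)
  exact
    { cs := fun s => (hc s).bitSize_le.trans (by omega)
      lam := fun j => (hl j).bitSize_le.trans (by omega)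
      nat := fun a ha => (hn a ha).bitSize_le.trans (by omega)
      cs_mul := fun s a ha => ((hc s).mul (hn a ha)).bitSize_le.trans (by omega)
      lam_mul := fun j => (hlk j).bitSize_le.trans (by omega)
      lam_mul_cs := fun j s => (hlc j s).bitSize_le.trans (by omega)
      sum := fun G => (hs G).bitSize_le.trans (by omega)
      sum_add := fun G j s => ((hs G).add (hlc j s)).bitSize_le.trans (by omega) }

theorem sized_zero (R : ℕ) : I.Sized (fun _ => 0) R := by
  constructor <;> intros <;> exact Nat.zero_le _

theorem bits_input (i : Fin (I.T + 1)) (A : I.Seq) :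
    (I.input i A).Bits (I.n + I.m + I.T + 1) := by
  have key : ∀ v, v ≤ I.n + I.m + I.T + 1 → Nat.size v ≤ I.n + I.m + I.T + 1 := fun v hv =>
    Nat.size_le.2 (hv.trans_lt Nat.lt_two_pow_self)
  have hi := i.isLt
  intro a x y
  apply key
  simp only [input]
  split
  · omega
  · omega
  · omega
  · omega
  · split_ifs
    · have := I.k_le ⟨_, by assumption⟩; omega
    · omega
  · split_ifs <;> omega
  · split_ifs <;> omega
  · omega

/-- The time bound of the algorithm. -/
noncomputable def timeBound : Polynomial ℕ :=
  -- Loops have at most `X + 1` iterations. The second factor bounds a single charge: the bits of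
  -- the input, their growth, and the size `8 X + 10` of the real numbers.
  main.work.comp (.X + 1) *
    (2 + (.X + 1) + main.work.comp (.X + 1) + (8 * .X + 10))

theorem exec_main {w : ℝ → ℕ} {x : ℕ} (hx : I.n + I.m + I.T ≤ x) (hw : I.Sized w (8 * x + 10))
    (i : Fin (I.T + 1)) (A : I.Seq) :
    ∃ M t, Exec w main.toProg (I.input i A) M t ∧
      I.output M = (I.thrifty (I.gr (I.best - 1) I.n) I.dFin I.fFin).act i A ∧
      t ≤ timeBound.eval x := by
  have hb : (I.input i A).Bits (x + 1) := Bits.mono (bits_input i A) (by omega)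
  obtain ⟨M, t, h1, h2, h3, -, -⟩ :=
    Code.sound main main_wf (wp_main hw (D := x + 1) (by omega) i A) hb le_rfl
  refine ⟨M, t, h1, h2, h3.trans_eq ?_⟩
  simp [timeBound]

theorem carriesOut_main :
    I.CarriesOut main.toProg timeBound (I.thrifty (I.gr (I.best - 1) I.n) I.dFin I.fFin) := by
  intro i A _
  refine ⟨exec_main le_rfl (sized_zero _) i A, fun h => exec_main ?_ (sized_bitSize h) i A⟩
  unfold bitLength; omega

end Problem

end RobustSetCover

theorem mainTheorem1 :
    ∃ (P : RobustSetCover.Prog) (p : Polynomial ℕ) (C : ℝ), ∀ I : RobustSetCover.Problem,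
      ∃ (τ : ℝ) (G : Finset (Fin I.m)) (d : Fin (I.T + 1)) (f : Fin I.n → Fin I.m),
        I.IsGreedyCover (I.net τ) G ∧
        (∀ j, I.lam d * I.k d ≤ I.lam j * I.k j) ∧
        (∀ e, I.IsMinSet e (f e)) ∧
        (I.thrifty G d f).Feasible ∧
        (I.thrifty G d f).robCov ≤ max 1 (C * (Real.log I.m + Real.log I.n)) * I.opt ∧
        I.CarriesOut P p (I.thrifty G d f) := by
  refine ⟨RobustSetCover.Code.main.toProg, RobustSetCover.Problem.timeBound, 32, fun I => ?_⟩
  -- The program works with an index of a net; the index it settles on is turned back into a real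
  -- threshold.
  obtain ⟨τ, hτ⟩ := RobustSetCover.Problem.exists_net_eq_netQ (I := I) (I.best - 1)
  refine ⟨τ, I.gr (I.best - 1) I.n, I.dFin, I.fFin, ?_, RobustSetCover.Problem.dFin_min,
    RobustSetCover.Problem.isMinSet_fFin, ?_, ?_, RobustSetCover.Problem.carriesOut_main⟩
  · rw [hτ]
    exact ⟨RobustSetCover.Problem.greedyReach_gr _ _, RobustSetCover.Problem.netQ_subset_cov _⟩
  · exact RobustSetCover.Problem.thrifty_feasible _ _ _
      fun e => (RobustSetCover.Problem.isMinSet_fFin e).1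
  · exact (RobustSetCover.Problem.robCov_le_val _).trans RobustSetCover.Problem.val_best_le_opt
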